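/- **Corollary (IFO complexity of R-AbaSRG).** *Problem.* Let $\mathcal M$ be a smooth finite-dimensional Riemannian manifold, $f=\frac1n\sum_{i=1}^n f_i$ with $n\ge 1$ and $f_i:\mathcal M\to\mathbb R$ of class $C^2$, $R$ a smooth retraction and $\mathcal T$ an isometric vector transport associated with $R$ (for $\xi\in T_x\mathcal M$, $\mathcal T_\xi:T_x\mathcal M\to T_{R_x(\xi)}\mathcal M$ is a linear isometry, $\mathcal T_{0_x}=\mathrm{id}$). Let $\mathcal X$ be a neighbourhood of a point $x^*$ with $f(x^*)\le f(x)$ for all $x\in\mathcal X$, and suppose that $\mathcal X$ is totally retractive: for some $\delta>0$ and every $x\in\mathcal X$, $R_x$ is a diffeomorphism from $\{\xi \in T_x\mathcal M:\|\xi\|<\delta\}$ onto an open set containing $\mathcal X$. Let $\sigma,L>0$ and $G,L_l,\theta\ge 0$ be such that for all $x\in\mathcal X$: $\|\mathrm{grad} f_i(x)\|\le G$ for every $i$; $\frac1n\sum_i\|\mathrm{grad} f_i(x)-\mathrm{grad} f(x)\|^2\le\sigma^2$; and, for all $\xi\in T_x\mathcal M$ with $\|\xi\|<\delta$ and $y=R_x(\xi)\in\mathcal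 X$, $$f(y)\le f(x)+\langle \mathrm{grad} f(x),\xi\rangle+\tfrac L2\|\xi\|^2,\qquad \frac1n\sum_i\|\mathrm{grad} f_i(x)-P_y^x\,\mathrm{grad} f_i(y)\|^2\le L_l^2\|\xi\|^2,$$ $$\|\mathcal T_\xi v-P_x^y v\|\le\theta\|\xi\|\|v\|\quad(v\in T_x\mathcal M),$$ where $P_x^y$ and $P_y^x=(P_x^y)^{-1}$ are the parallel transports along the curve $t\mapsto R_x(t\xi)$, $0\le t\le1$. *Algorithm (R-AbaSRG).* Inputs: $\eta,S,m,b,\alpha_1,\alpha_2,\beta_1,\epsilon$ and $\tilde x^0$. For $s=1,\dots,S$: put $x_0^s=\tilde x^{s-1}$ and $$\bar B^s=\min\{\alpha_1\sigma^2/\beta_s,\,n\}\ \text{(finite-sum)},\qquad \bar B^s=\min\{\alpha_1\sigma^2/\beta_s,\,\alpha_2\sigma^2/\epsilon^2\}\ \text{(online)},$$ with $\alpha_1\sigma^2/0=\infty$; draw uniformly without replacement a sample $\mathcal B^s\subset[n]$ of size $\min\{\lceil \bar B^s\rceil,n\}$, and set $v_0^s=\mathrm{grad} f_{\mathcal B^s}(x_0^s)$;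 put $x^s_{t+1}=R_{x_t^s}(-\eta v_t^s)$ for $0\le t\le m-1$, where for $1\le t\le m-1$, drawing a sample $\mathcal I_t^s$ of size $b$ from $[n]$ uniformly with replacement, $$v_t^s=\mathrm{grad} f_{\mathcal I_t^s}(x_t^s)-\mathcal T_{-\eta v_{t-1}^s}\big(\mathrm{grad} f_{\mathcal I_t^s}(x_{t-1}^s)-v_{t-1}^s\big);$$ set $\tilde x^s=x_m^s$ and $\beta_{s+1}=\frac1m\sum_{t=0}^{m-1}\|v_t^s\|^2$. Here $\mathrm{grad} f_{\mathcal I}$ is the average of $\mathrm{grad} f_i$ over the sample $\mathcal I$. The output $\tilde x$ is uniform in $\{x_t^s: 1\le s\le S,\ 0\le t\le m-1\}$. The IFO cost of a run is the number of evaluations of a pair $(i,x)\mapsto\mathrm{grad} f_i(x)$, that is, $\sum_{s=1}^S\big(|\mathcal B^s|+2(m-1)b\big)$; its average batch size is $\tilde B=\frac1S\sum_{s=1}^S\bar B^s$. *Statement.* There are absolute constants $\varrho_2,C>0$ with the following property. Put $\Delta=f(\tilde x^0)-f(x^*)$, assume $\Delta>0$, and let $$\eta=\frac{3}{2L+2\sqrt{L^2+3(L_l+\theta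 G)^2}},\quad b=m,\quad S=\Big\lceil\frac{4\Delta}{m\eta\epsilon^2}\Big\rceil,\quad \Theta_2=L+\sqrt{L^2+\varrho_2(L_l+\theta G)^2},$$ $\alpha_1,\alpha_2\ge\alpha=4$ and $0<\beta_1\le\epsilon^2S$, with $m=\lfloor\sqrt n\rfloor$ in the finite-sum setting and $m=\lfloor\sigma/\epsilon\rfloor$, $0<\epsilon\le\sigma$, in the online setting ($\epsilon>0$ in both). Assume that in every run the iterates stay continuously in $\mathcal X$ (all points $R_{x_t^s}(-\tau\eta v_t^s)$, $0\le\tau\le1$, lie in $\mathcal X$). Then the output is an $\epsilon$-accurate solution, $\mathbb E\|\mathrm{grad} f(\tilde x)\|\le\epsilon$, and, if $4\Delta/(m\eta\epsilon^2)\ge1$ (that is, $\epsilon$ is small enough), the IFO cost of every run is at most $$C\Big(\tilde B+\frac{\Delta\Theta_2\tilde B}{\sqrt n\,\epsilon^2}+\frac{\Delta\Theta_2\sqrt n}{\epsilon^2}\Big)\ \text{(finite-sum)},\qquad C\Big(\frac{\Delta\Theta_2\tilde B}{\sigma\epsilon}+\frac{\Delta\Theta_2\sigma}{\epsilon^3}\Big)\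 \text{(online)}.$$ -/

import Mathlib

open Bundle Manifold
open scoped ContDiff Topology BigOperators

noncomputable section

namespace AbaSRG

variable {E : Type*} [NormedAddCommGroup E] [NormedSpace ℝ E] [FiniteDimensional ℝ E]
  {M : Type*} [TopologicalSpace M] [ChartedSpace E M] [IsManifold 𝓘(ℝ, E) ∞ M]
  [RiemannianBundle (fun x : M => TangentSpace 𝓘(ℝ, E) x)]

/-! ### Riemannian gradient and parallel transport -/

instance finiteDimensional_tangentSpace (x : M) :
    FiniteDimensional ℝ (TangentSpace 𝓘(ℝ, E) x) :=
  inferInstanceAs (FiniteDimensional ℝ E)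

instance completeSpace_tangentSpace (x : M) : CompleteSpace (TangentSpace 𝓘(ℝ, E) x) :=
  FiniteDimensional.complete ℝ (TangentSpace 𝓘(ℝ, E) x)

/-- The differential of `f : M → ℝ` at `x`, as a linear form on `T_x M`. -/
def differential (f : M → ℝ) (x : M) : TangentSpace 𝓘(ℝ, E) x →L[ℝ] ℝ :=
  mfderiv 𝓘(ℝ, E) 𝓘(ℝ, ℝ) f x

/-- The Riemannian gradient: the Riesz representative of the differential. -/
def grad (f : M → ℝ) (x : M) : TangentSpace 𝓘(ℝ, E) x :=
  (InnerProductSpace.toDual ℝ (TangentSpace 𝓘(ℝ, E) x)).symm (differential f x)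

/-- The Riemannian metric in the preferred chart around `p`: for coordinate vectors `v w : E`,
the number `g_z(v, w)` at the point of coordinates `z : E`. -/
def metricCoord (p : M) (v w z : E) : ℝ :=
  inner ℝ
    ((trivializationAt E (TangentSpace 𝓘(ℝ, E) : M → Type _) p).symmL ℝ
      ((extChartAt 𝓘(ℝ, E) p).symm z) v)
    ((trivializationAt E (TangentSpace 𝓘(ℝ, E) : M → Type _) p).symmL ℝ
      ((extChartAt 𝓘(ℝ, E) p).symm z) w)

/-- The derivative `∂_u g(v, w)` of the coordinate metric at `p`, in the direction `u`. -/
def dMetricCoord (p : M) (u v w : E) : ℝ :=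
  fderiv ℝ (metricCoord p v w) (extChartAt 𝓘(ℝ, E) p p) u

/-- `g(Γ(u, v), w)` at `p`, in the preferred chart around `p`, where `Γ` is the Christoffel symbol
of the Levi-Civita connection (Christoffel symbol of the first kind). -/
def christoffel (p : M) (u v w : E) : ℝ :=
  (1 / 2) * (dMetricCoord p u v w + dMetricCoord p v u w - dMetricCoord p w u v)

/-- The vector field `V` (along the curve `t ↦ (V t).proj`) is parallel on `[0, 1]` for the
Levi-Civita connection: at each time `t`, in the preferred chart around the point reached, the
coordinates `c` of the curve and `v` of the field satisfy `v' + Γ(c', v) = 0`. -/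
structure IsParallel (V : ℝ → TangentBundle 𝓘(ℝ, E) M) : Prop where
  continuousOn_proj : ContinuousOn (fun t => (V t).proj) (Set.Icc 0 1)
  parallel : ∀ t ∈ Set.Icc (0 : ℝ) 1, ∃ c' v' : E,
    HasDerivWithinAt (fun τ => extChartAt 𝓘(ℝ, E) (V t).proj (V τ).proj) c' (Set.Icc 0 1) t ∧
    HasDerivWithinAt
      (fun τ => (trivializationAt E (TangentSpace 𝓘(ℝ, E) : M → Type _) (V t).proj (V τ)).2)
      v' (Set.Icc 0 1) t ∧
    ∀ w : E,
      metricCoord (V t).proj v' w (extChartAt 𝓘(ℝ, E) (V t).proj (V t).proj) +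
        christoffel (V t).proj c'
          (trivializationAt E (TangentSpace 𝓘(ℝ, E) : M → Type _) (V t).proj (V t)).2 w = 0

/-! ### Retractions and vector transports -/

variable (E M) in
/-- A retraction: a smooth map `R : TM → M` with `R_x(0) = x` and `D R_x(0)[ξ] = ξ`
(the last identity is written in the preferred chart around `x`). -/
structure Retraction where
  toFun : ∀ x : M, TangentSpace 𝓘(ℝ, E) x → M
  contMDiff : ContMDiff (𝓘(ℝ, E).prod 𝓘(ℝ, E)) 𝓘(ℝ, E) ∞
    (fun p : TangentBundle 𝓘(ℝ, E) M => toFun p.proj p.2)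
  map_zero : ∀ x, toFun x 0 = x
  deriv_zero : ∀ (x : M) (ξ : TangentSpace 𝓘(ℝ, E) x),
    HasDerivAt (fun t : ℝ => extChartAt 𝓘(ℝ, E) x (toFun x (t • ξ))) (show E from ξ) 0

instance : CoeFun (Retraction E M) fun _ => ∀ x : M, TangentSpace 𝓘(ℝ, E) x → M :=
  ⟨Retraction.toFun⟩

/-- An isometric vector transport associated with `R`: linear isometries
`T_ξ : T_x M → T_{R_x(ξ)} M` with `T_0 = id`. -/
structure VectorTransport (R : Retraction E M) where
  toFun : ∀ (x : M) (ξ : TangentSpace 𝓘(ℝ, E) x),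
    TangentSpace 𝓘(ℝ, E) x →ₗᵢ[ℝ] TangentSpace 𝓘(ℝ, E) (R x ξ)
  map_zero : ∀ (x : M) (v : TangentSpace 𝓘(ℝ, E) x),
    (⟨R x 0, toFun x 0 v⟩ : TangentBundle 𝓘(ℝ, E) M) = ⟨x, v⟩

instance (R : Retraction E M) : CoeFun (VectorTransport R) fun _ =>
    ∀ (x : M) (ξ : TangentSpace 𝓘(ℝ, E) x),
      TangentSpace 𝓘(ℝ, E) x →ₗᵢ[ℝ] TangentSpace 𝓘(ℝ, E) (R x ξ) :=
  ⟨VectorTransport.toFun⟩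

/-- `w ∈ T_y M`, `y = R_x(ξ)`, is the parallel transport of `u ∈ T_x M` along the retraction curve
`c(t) = R_x(tξ)`, `0 ≤ t ≤ 1`. Equivalently, `u` is the parallel transport of `w` from `y` back to
`x` along that curve. -/
def IsParallelTransport (R : Retraction E M) (x : M) (ξ u : TangentSpace 𝓘(ℝ, E) x)
    (w : TangentSpace 𝓘(ℝ, E) (R x ξ)) : Prop :=
  ∃ V : ℝ → TangentBundle 𝓘(ℝ, E) M,
    (∀ t ∈ Set.Icc (0 : ℝ) 1, (V t).proj = R x (t • ξ)) ∧
    V 0 = ⟨x, u⟩ ∧ V 1 = ⟨R x ξ, w⟩ ∧ IsParallel V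

/-- `X` is totally retractive with radius `δ`: for every `x ∈ X`, `R_x` restricts to a
diffeomorphism from the ball `{‖ξ‖ < δ}` of `T_x M` onto an open set that contains `X`. -/
def IsTotallyRetractive (R : Retraction E M) (X : Set M) (δ : ℝ) : Prop :=
  0 < δ ∧ ∀ x ∈ X,
    ∃ Φ : PartialDiffeomorph 𝓘(ℝ, TangentSpace 𝓘(ℝ, E) x) 𝓘(ℝ, E)
        (TangentSpace 𝓘(ℝ, E) x) M ∞,
      Φ.source = Metric.ball 0 δ ∧ Set.EqOn Φ (R x) (Metric.ball 0 δ) ∧ X ⊆ Φ.target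

/-! ### The problem and its standing assumptions -/

/-- The objective function `f = (1/n) ∑ f_i`. -/
def objective {n : ℕ} (f : Fin n → M → ℝ) (x : M) : ℝ := (1 / (n : ℝ)) * ∑ i, f i x

/-- The standing assumptions on the problem, around an optimal point `xs`. -/
structure Assumptions {n : ℕ} (f : Fin n → M → ℝ) (R : Retraction E M) (T : VectorTransport R)
    (X : Set M) (xs : M) (δ G σ L Ll θ : ℝ) : Prop where
  contMDiff : ∀ i, ContMDiff 𝓘(ℝ, E) 𝓘(ℝ, ℝ) 2 (f i)
  mem_nhds : X ∈ 𝓝 xs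
  isMinOn : IsMinOn (objective f) X xs
  retractive : IsTotallyRetractive R X δ
  gradBound : ∀ x ∈ X, ∀ i, ‖grad (E := E) (f i) x‖ ≤ G
  variance : ∀ x ∈ X,
    (1 / (n : ℝ)) * ∑ i, ‖grad (E := E) (f i) x - grad (objective f) x‖ ^ 2 ≤ σ ^ 2
  smooth : ∀ x ∈ X, ∀ ξ : TangentSpace 𝓘(ℝ, E) x, ‖ξ‖ < δ → R x ξ ∈ X →
    objective f (R x ξ) ≤
      objective f x + inner ℝ (grad (objective f) x) ξ + L / 2 * ‖ξ‖ ^ 2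
  /-- Average Lipschitz continuity of the component gradients: `u i` is the parallel transport of
  `grad f_i(y)` from `y = R_x(ξ)` back to `x`. -/
  lipschitz : ∀ x ∈ X, ∀ ξ : TangentSpace 𝓘(ℝ, E) x, ‖ξ‖ < δ → R x ξ ∈ X →
    ∃ u : Fin n → TangentSpace 𝓘(ℝ, E) x,
      (∀ i, IsParallelTransport R x ξ (u i) (grad (f i) (R x ξ))) ∧
      (1 / (n : ℝ)) * ∑ i, ‖grad (f i) x - u i‖ ^ 2 ≤ Ll ^ 2 * ‖ξ‖ ^ 2
  /-- `w` is the parallel transport of `v` from `x` to `R_x(ξ)`. -/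
  transport : ∀ x ∈ X, ∀ ξ : TangentSpace 𝓘(ℝ, E) x, ‖ξ‖ < δ → R x ξ ∈ X →
    ∀ v : TangentSpace 𝓘(ℝ, E) x, ∃ w, IsParallelTransport R x ξ v w ∧
      ‖T x ξ v - w‖ ≤ θ * ‖ξ‖ * ‖v‖

/-! ### The algorithm -/

inductive Setting
  | finiteSum
  | online

variable (M) in
/-- Input of the algorithm: step size, number of epochs, inner loop size, mini-batch size, the
adaptive batch size parameters, variance bound, desired accuracy and initial point. -/
structure Input where
  η : ℝ
  S : ℕ
  m : ℕ
  b : ℕ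
  α₁ : ℝ
  α₂ : ℝ
  β₁ : ℝ
  σ : ℝ
  ε : ℝ
  x₀ : M

/-- The largest (real) batch size: `n` for finite sums, `α₂σ²/ε²` online. -/
def Input.cap (P : Input M) (n : ℕ) : Setting → ℝ
  | .finiteSum => n
  | .online => P.α₂ * P.σ ^ 2 / P.ε ^ 2

/-- The real number `min {α₁σ²/β, cap}`, with `α₁σ²/0 = ∞`. -/
def Input.realBatch (P : Input M) (n : ℕ) (mode : Setting) (β : ℝ) : ℝ :=
  if β = 0 then P.cap n mode else min (P.α₁ * P.σ ^ 2 / β) (P.cap n mode)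

/-- The batch size actually drawn: the real one rounded up (and at most the population size). -/
def Input.batch (P : Input M) (n : ℕ) (mode : Setting) (β : ℝ) : ℕ :=
  min ⌈P.realBatch n mode β⌉₊ n

/-- The average `(1/k) ∑_j grad f_{I_j}(x)` over a sample `I` of size `k`. -/
def sampleGrad {n k : ℕ} (f : Fin n → M → ℝ) (I : Fin k → Fin n) (x : M) :
    TangentSpace 𝓘(ℝ, E) x :=
  (1 / (k : ℝ)) • ∑ j, grad (f (I j)) x

/-- The random draws, uniformly distributed on this finite type: in each epoch a permutation of the
indices, whose first `B` values are the sample of size `B` without replacement, and `m - 1`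
mini-batches of size `b`, drawn with replacement. -/
abbrev Draws (n S m b : ℕ) : Type :=
  Fin S → Equiv.Perm (Fin n) × (Fin (m - 1) → Fin b → Fin n)

section Algorithm

variable {n : ℕ} (f : Fin n → M → ℝ) (R : Retraction E M) (T : VectorTransport R)
  (P : Input M) (mode : Setting)

/-- The pair `(x_0, v_0)` of an epoch which starts at `x` with batch parameter `β`. -/
def firstPair (x : M) (β : ℝ) (p : Equiv.Perm (Fin n)) : TangentBundle 𝓘(ℝ, E) M :=
  ⟨x, sampleGrad f
    (fun j : Fin (P.batch n mode β) => p (Fin.castLE (min_le_right _ _) j)) x⟩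

/-- The point `R_x(-ηv)` reached from the pair `(x, v)`. -/
def move (z : TangentBundle 𝓘(ℝ, E) M) : M := R z.proj (-(P.η • z.2))

/-- One inner iteration `(x_{t-1}, v_{t-1}) ↦ (x_t, v_t)` with mini-batch `I`. -/
def nextPair (I : Fin P.b → Fin n) (z : TangentBundle 𝓘(ℝ, E) M) : TangentBundle 𝓘(ℝ, E) M :=
  ⟨move R P z, sampleGrad f I (move R P z) -
    T z.proj (-(P.η • z.2)) (sampleGrad f I z.proj - z.2)⟩

/-- The pair `(x_t, v_t)`, `0 ≤ t ≤ m - 1`, of an epoch (constant for larger `t`). -/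
def innerPair (x : M) (β : ℝ)
    (d : Equiv.Perm (Fin n) × (Fin (P.m - 1) → Fin P.b → Fin n)) :
    ℕ → TangentBundle 𝓘(ℝ, E) M
  | 0 => firstPair f P mode x β d.1
  | t + 1 =>
    if h : t < P.m - 1 then nextPair f R T P (d.2 ⟨t, h⟩) (innerPair x β d t)
    else innerPair x β d t

/-- The starting point and the batch parameter `β` of epoch `s` (epochs are numbered from `0`). -/
def epochStart (d : Draws n P.S P.m P.b) : ℕ → M × ℝ
  | 0 => (P.x₀, P.β₁)
  | s + 1 =>
    if h : s < P.S then
      (move R P (innerPair f R T P mode (epochStart d s).1 (epochStart d s).2 (d ⟨s, h⟩)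
          (P.m - 1)),
        ∑ t ∈ Finset.range P.m,
          ‖(innerPair f R T P mode (epochStart d s).1 (epochStart d s).2 (d ⟨s, h⟩) t).2‖ ^ 2
            / P.m)
    else epochStart d s

/-- The pair `(x_t^s, v_t^s)`. -/
def pair (d : Draws n P.S P.m P.b) (s : Fin P.S) (t : Fin P.m) : TangentBundle 𝓘(ℝ, E) M :=
  innerPair f R T P mode (epochStart f R T P mode d s).1 (epochStart f R T P mode d s).2 (d s) t

/-- In every run, the iterates stay continuously in `X`: all the points `R_{x_t}(-τηv_t)`,
`0 ≤ τ ≤ 1`, between successive iterates (included) are in `X`. -/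
def StaysIn (X : Set M) : Prop :=
  ∀ (d : Draws n P.S P.m P.b) (s : Fin P.S) (t : Fin P.m), ∀ τ ∈ Set.Icc (0 : ℝ) 1,
    R (pair f R T P mode d s t).proj (-(τ • P.η • (pair f R T P mode d s t).2)) ∈ X

/-- The expected norm of `grad f` at the output, which is an iterate `x_t^s` chosen uniformly. -/
def expectedGradNorm : ℝ :=
  𝔼 o : Draws n P.S P.m P.b × Fin P.S × Fin P.m,
    ‖grad (E := E) (objective f) (pair f R T P mode o.1 o.2.1 o.2.2).proj‖

/-- The number of calls of the incremental first-order oracle in a run: the batch at the start of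
each epoch, then in each of the `m - 1` inner iterations the mini-batch at two points. -/
def ifoCalls (d : Draws n P.S P.m P.b) : ℕ :=
  ∑ s : Fin P.S, (P.batch n mode (epochStart f R T P mode d s).2 + (P.m - 1) * (2 * P.b))

/-- The average batch size `B̃ = (1/S) ∑_s min {α₁σ²/β_s, cap}` of a run. -/
def avgBatch (d : Draws n P.S P.m P.b) : ℝ :=
  (1 / (P.S : ℝ)) * ∑ s : Fin P.S, P.realBatch n mode (epochStart f R T P mode d s).2

end Algorithm

/-- The step size `3 / (2L + 2√(L² + 3(L_l + θG)²))`. -/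
def stepSize (L Ll θ G : ℝ) : ℝ := 3 / (2 * L + 2 * √(L ^ 2 + 3 * (Ll + θ * G) ^ 2))

/-- `Θ₂ = L + √(L² + ϱ(L_l + θG)²)`. -/
def Theta (ϱ L Ll θ G : ℝ) : ℝ := L + √(L ^ 2 + ϱ * (Ll + θ * G) ^ 2)

end AbaSRG

end

/-! Write `ℓ = Ll + θ G` and let `e_t` be the squared error `‖v_t - grad f(x_t)‖²`. Smoothness and
polarization bound `f(x_{t+1})` by `f(x_t) - (η/2)‖grad f(x_t)‖² - (η/2)(1 - Lη)‖v_t‖² + (η/2) e_t`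
(`Assumptions.descent`), so the matter is to control `e_t` on average.

Within an epoch, the new error is a centred sample mean of `grad f_i(x_{t+1}) - T grad f_i(x_t)`
plus the isometric image of the old error. The cross term has mean zero, hence `E e_{t+1} ≤ E e_t +
((ℓη)²/b) E‖v_t‖²` (`expect_sqError_nextPair_le`). With `b = m` this sums to `E ∑ e_t ≤ m E e_0 +
(ℓη)² E ∑‖v_t‖²`. The batch rule makes `E e_0` at most `E β_s / 4 + κ`, where `κ` pays for capped
batches (`expect_sqError_firstPair_le`).

The step size solves `Lη + (ℓη)² = 3/4`, so `(η/8) ∑‖v_t‖² = (ηm/8) β_{s+1}` is left over, while the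
initial error costs `(ηm/8) β_s`. These match, and the potential `f + (ηm/8) β` telescopes
(`expect_potential_succ_le`). Jensen's inequality concludes.

The constant `ℓ` comes from comparing the vector transport with parallel transport, which is
isometric because the Levi-Civita connection is metric (`IsParallel.inner_eq`). The oracle count is
deterministic: `S` is of order `ΔΘ₂/(mε²)`, and an epoch costs at most its real batch size plus
`2m²` (`ifoCalls_le`). -/

noncomputable section

namespace AbaSRG

variable {E : Type*} [NormedAddCommGroup E] [NormedSpace ℝ E] [FiniteDimensional ℝ E]
  {M : Type*} [TopologicalSpace M] [ChartedSpace E M] [IsManifold 𝓘(ℝ, E) ∞ M]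
  [RiemannianBundle (fun x : M => TangentSpace 𝓘(ℝ, E) x)]

set_option linter.unusedSectionVars false

/-! ### Parallel transport is isometric -/

/-- The coordinates of `u ∈ T_x M` in the preferred chart around `p`. -/
def tangentCoord (p : M) {x : M} (u : TangentSpace 𝓘(ℝ, E) x) : E :=
  (trivializationAt E (TangentSpace 𝓘(ℝ, E) : M → Type _) p ⟨x, u⟩).2

theorem inner_eq_metricCoord {p x : M} (hx : x ∈ (chartAt E p).source)
    (u v : TangentSpace 𝓘(ℝ, E) x) :
    inner ℝ u v =
      metricCoord p (tangentCoord p u) (tangentCoord p v) (extChartAt 𝓘(ℝ, E) p x) := by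
  have hx' : x ∈ (trivializationAt E (TangentSpace 𝓘(ℝ, E) : M → Type _) p).baseSet := by
    simpa using hx
  -- Going through the chart and back returns `x` only propositionally; a free `y` lets the equality
  -- be eliminated by `rfl` despite the dependent fibres.
  have key : ∀ y : M, y = x →
      inner ℝ u v = inner ℝ
        ((trivializationAt E (TangentSpace 𝓘(ℝ, E) : M → Type _) p).symmL ℝ y
          (tangentCoord p u))
        ((trivializationAt E (TangentSpace 𝓘(ℝ, E) : M → Type _) p).symmL ℝ y
          (tangentCoord p v)) := by
    rintro y rfl
    have h (a : TangentSpace 𝓘(ℝ, E) y) :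
        (trivializationAt E (TangentSpace 𝓘(ℝ, E) : M → Type _) p).symmL ℝ y
          (tangentCoord p a) = a := by
      have := (trivializationAt E (TangentSpace 𝓘(ℝ, E) : M → Type _)
        p).symmL_continuousLinearMapAt (R := ℝ) hx' a
      rwa [Trivialization.continuousLinearMapAt_apply,
        Trivialization.linearMapAt_apply, if_pos hx'] at this
    rw [h u, h v]
  exact key _ ((extChartAt 𝓘(ℝ, E) p).left_inv (by rwa [extChartAt_source]))

theorem metricCoord_comm (p : M) (v w z : E) : metricCoord p v w z = metricCoord p w v z :=
  real_inner_comm _ _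

theorem dMetricCoord_comm (p : M) (u v w : E) : dMetricCoord p u v w = dMetricCoord p u w v := by
  unfold dMetricCoord
  rw [show metricCoord p v w = metricCoord p w v from funext (metricCoord_comm p v w)]

/-- Bilinearity separates the dependence on `z` from that on `v` and `w`, so the product rule only
has to differentiate the components `g_ij`. -/
theorem metricCoord_eq_sum {ι : Type*} [Fintype ι] (e : Module.Basis ι ℝ E) (p : M) (v w z : E) :
    metricCoord p v w z = ∑ i, ∑ j, e.repr v i * e.repr w j * metricCoord p (e i) (e j) z := by
  conv_lhs => rw [← e.sum_repr v, ← e.sum_repr w]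
  simp only [metricCoord, map_sum, map_smul, sum_inner, inner_sum, real_inner_smul_left,
    real_inner_smul_right, mul_assoc]
  rw [Finset.sum_comm]
  refine Finset.sum_congr rfl fun i _ => Finset.sum_congr rfl fun j _ => ?_
  ring

section Smooth

variable [IsContMDiffRiemannianBundle 𝓘(ℝ, E) ∞ E (fun x : M => TangentSpace 𝓘(ℝ, E) x)]

theorem differentiableAt_metricCoord (p : M) (v w : E) :
    DifferentiableAt ℝ (metricCoord p v w) (extChartAt 𝓘(ℝ, E) p p) := by
  -- The coordinate frame is smooth because it is constant in the trivialization at `p`.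
  have hsec (a : E) : ContMDiffAt 𝓘(ℝ, E) (𝓘(ℝ, E).prod 𝓘(ℝ, E)) 1
      (fun y : M => (⟨y, (trivializationAt E (TangentSpace 𝓘(ℝ, E) : M → Type _) p).symmL ℝ y a⟩ :
        TotalSpace E (TangentSpace 𝓘(ℝ, E) : M → Type _))) p := by
    rw [contMDiffAt_section]
    refine (contMDiffAt_const (c := a)).congr_of_eventuallyEq ?_
    filter_upwards [(chartAt E p).open_source.mem_nhds (mem_chart_source E p)] with y hy
    have hy' : y ∈ (trivializationAt E (TangentSpace 𝓘(ℝ, E) : M → Type _) p).baseSet := by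
      simpa using hy
    have := (trivializationAt E (TangentSpace 𝓘(ℝ, E) : M → Type _)
        p).continuousLinearMapAt_symmL (R := ℝ) hy' a
    rwa [Trivialization.continuousLinearMapAt_apply,
        Trivialization.linearMapAt_apply, if_pos hy'] at this
  have hin : MDifferentiableAt 𝓘(ℝ, E) 𝓘(ℝ, ℝ) (fun y : M => (inner ℝ
      ((trivializationAt E (TangentSpace 𝓘(ℝ, E) : M → Type _) p).symmL ℝ y v)
      ((trivializationAt E (TangentSpace 𝓘(ℝ, E) : M → Type _) p).symmL ℝ y w) : ℝ))
      p := by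
    refine ContMDiffAt.mdifferentiableAt (n := 1) ?_ one_ne_zero
    refine ContMDiffAt.inner_bundle (F := E) (E := fun x : M => TangentSpace 𝓘(ℝ, E) x)
      (IB := 𝓘(ℝ, E)) (b := fun y => y) ?_ ?_
    exacts [hsec v, hsec w]
  have hsymm : MDifferentiableAt 𝓘(ℝ, E) 𝓘(ℝ, E) (extChartAt 𝓘(ℝ, E) p).symm
      (extChartAt 𝓘(ℝ, E) p p) :=
    ((contMDiffOn_extChartAt_symm (I := 𝓘(ℝ, E)) (n := 1) p).contMDiffAt
      (extChartAt_target_mem_nhds p)).mdifferentiableAt one_ne_zero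
  rw [← mdifferentiableAt_iff_differentiableAt]
  exact hin.comp_of_eq _ hsymm (extChartAt_to_inv p)

/-- The product rule for the coordinate metric along a curve. -/
theorem hasDerivWithinAt_metricCoord {p : M} {s : Set ℝ} {t : ℝ} {a b c : ℝ → E} {a' b' c' : E}
    (ha : HasDerivWithinAt a a' s t) (hb : HasDerivWithinAt b b' s t)
    (hc : HasDerivWithinAt c c' s t) (hp : c t = extChartAt 𝓘(ℝ, E) p p) :
    HasDerivWithinAt (fun τ => metricCoord p (a τ) (b τ) (c τ))
      (metricCoord p a' (b t) (c t) + metricCoord p (a t) b' (c t) +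
        dMetricCoord p c' (a t) (b t)) s t := by
  have e := Module.finBasis ℝ E
  have hrepr (x : ℝ → E) (x' : E) (hx : HasDerivWithinAt x x' s t) (i) :
      HasDerivWithinAt (fun τ => e.repr (x τ) i) (e.repr x' i) s t :=
    ((LinearMap.toContinuousLinearMap (e.coord i)).hasFDerivAt.comp_hasDerivWithinAt t hx)
  have hd (v w : E) : HasFDerivAt (metricCoord p v w) (fderiv ℝ (metricCoord p v w) (c t)) (c t) :=
    (hp ▸ differentiableAt_metricCoord p v w).hasFDerivAt
  have hg (v w : E) : HasDerivWithinAt (fun τ => metricCoord p v w (c τ))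
      (dMetricCoord p c' v w) s t := by
    have := (hd v w).comp_hasDerivWithinAt t hc
    rw [hp] at this
    exact this
  have hsum : dMetricCoord p c' (a t) (b t) = ∑ i, ∑ j, e.repr (a t) i * e.repr (b t) j *
      dMetricCoord p c' (e i) (e j) := by
    have h1 : HasFDerivAt (metricCoord p (a t) (b t)) (∑ i, ∑ j,
        (e.repr (a t) i * e.repr (b t) j) • fderiv ℝ (metricCoord p (e i) (e j)) (c t)) (c t) := by
      rw [show metricCoord p (a t) (b t) = fun z => ∑ i, ∑ j, e.repr (a t) i * e.repr (b t) j *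
        metricCoord p (e i) (e j) z from funext fun z => metricCoord_eq_sum e p _ _ z]
      exact HasFDerivAt.fun_sum fun i _ => HasFDerivAt.fun_sum fun j _ =>
        (hd (e i) (e j)).const_mul _
    unfold dMetricCoord
    rw [← hp, h1.fderiv]
    simp
  have hmain : HasDerivWithinAt (fun τ => ∑ i, ∑ j, e.repr (a τ) i * e.repr (b τ) j *
      metricCoord p (e i) (e j) (c τ)) (∑ i, ∑ j, ((e.repr a' i * e.repr (b t) j +
        e.repr (a t) i * e.repr b' j) * metricCoord p (e i) (e j) (c t) +
        e.repr (a t) i * e.repr (b t) j * dMetricCoord p c' (e i) (e j))) s t :=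
    HasDerivWithinAt.fun_sum fun i _ => HasDerivWithinAt.fun_sum fun j _ =>
      ((hrepr a a' ha i).mul (hrepr b b' hb j)).mul (hg (e i) (e j))
  rw [show (fun τ => metricCoord p (a τ) (b τ) (c τ)) = fun τ => ∑ i, ∑ j, e.repr (a τ) i *
    e.repr (b τ) j * metricCoord p (e i) (e j) (c τ) from
      funext fun τ => metricCoord_eq_sum e p _ _ _]
  convert! hmain using 1
  rw [hsum, metricCoord_eq_sum e p a', metricCoord_eq_sum e p _ b']
  simp only [← Finset.sum_add_distrib]
  refine Finset.sum_congr rfl fun i _ => Finset.sum_congr rfl fun j _ => ?_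
  ring

/-- The inner product of two parallel fields along a curve is constant. -/
theorem IsParallel.inner_eq {c : ℝ → M} {u v : ∀ t, TangentSpace 𝓘(ℝ, E) (c t)}
    (hu : IsParallel (fun t => (⟨c t, u t⟩ : TangentBundle 𝓘(ℝ, E) M)))
    (hv : IsParallel (fun t => (⟨c t, v t⟩ : TangentBundle 𝓘(ℝ, E) M))) :
    (inner ℝ (u 1) (v 1) : ℝ) = inner ℝ (u 0) (v 0) := by
  have hderiv : ∀ t ∈ Set.Icc (0 : ℝ) 1,
      HasDerivWithinAt (fun τ => (inner ℝ (u τ) (v τ) : ℝ)) 0 (Set.Icc 0 1) t := by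
    intro t ht
    obtain ⟨c', a', hc, ha, hua⟩ := hu.parallel t ht
    obtain ⟨c'', b', hc2, hb, hvb⟩ := hv.parallel t ht
    obtain rfl : c' = c'' := (uniqueDiffOn_Icc zero_lt_one t ht).eq_deriv _ hc hc2
    have hprod := hasDerivWithinAt_metricCoord (p := c t) ha hb hc rfl
    -- Metric compatibility: in `g(Γ(c', u), v) + g(Γ(c', v), u)` the terms not differentiated along
    -- `c'` cancel, which leaves `∂_{c'} g(u, v)`.
    have hzero : metricCoord (c t) a' (tangentCoord (c t) (v t)) (extChartAt 𝓘(ℝ, E) (c t) (c t)) +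
        metricCoord (c t) (tangentCoord (c t) (u t)) b' (extChartAt 𝓘(ℝ, E) (c t) (c t)) +
        dMetricCoord (c t) c' (tangentCoord (c t) (u t)) (tangentCoord (c t) (v t)) = 0 := by
      have h1 := hua (tangentCoord (c t) (v t))
      have h2 := hvb (tangentCoord (c t) (u t))
      rw [metricCoord_comm (c t) _ b']
      change _ + christoffel (c t) c' (tangentCoord (c t) (u t)) _ = 0 at h1
      change _ + christoffel (c t) c' (tangentCoord (c t) (v t)) _ = 0 at h2
      unfold christoffel at h1 h2
      rw [dMetricCoord_comm _ _ (tangentCoord (c t) (v t)) (tangentCoord (c t) (u t))] at h2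
      dsimp only at h1 h2
      linarith
    refine (hprod.congr_deriv hzero).congr_of_eventuallyEq_of_mem ?_ ht
    have hnhds : (chartAt E (c t)).source ∈ 𝓝 (c t) :=
      (chartAt E (c t)).open_source.mem_nhds (mem_chart_source E (c t))
    filter_upwards [(hu.continuousOn_proj t ht) hnhds] with τ hτ
    exact inner_eq_metricCoord hτ (u τ) (v τ)
  exact constant_of_has_deriv_right_zero (fun t ht => (hderiv t ht).continuousWithinAt)
    (fun t ht => ((hderiv t ⟨ht.1, ht.2.le⟩).mono_of_mem_nhdsWithin
      (Icc_mem_nhdsGE_of_mem ht))) 1 ⟨zero_le_one, le_rfl⟩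

end Smooth


/-! ### Consequences of the standing assumptions -/

theorem inner_congr_of_eq {a b : M} {u v : TangentSpace 𝓘(ℝ, E) a} {u' v' : TangentSpace 𝓘(ℝ, E) b}
    (hu : (⟨a, u⟩ : TangentBundle 𝓘(ℝ, E) M) = ⟨b, u'⟩)
    (hv : (⟨a, v⟩ : TangentBundle 𝓘(ℝ, E) M) = ⟨b, v'⟩) :
    (inner ℝ u v : ℝ) = inner ℝ u' v' := by
  obtain rfl : a = b := congrArg TotalSpace.proj hu
  obtain rfl : u = u' := eq_of_heq (TotalSpace.ext_iff.1 hu).2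
  obtain rfl : v = v' := eq_of_heq (TotalSpace.ext_iff.1 hv).2
  rfl

theorem IsParallel.congr {V W : ℝ → TangentBundle 𝓘(ℝ, E) M} (hV : IsParallel V)
    (h : ∀ t ∈ Set.Icc (0 : ℝ) 1, W t = V t) : IsParallel W where
  continuousOn_proj := hV.continuousOn_proj.congr fun t ht => by rw [h t ht]
  parallel t ht := by
    obtain ⟨c', v', hc, hv, hw⟩ := hV.parallel t ht
    refine ⟨c', v', ?_, ?_, ?_⟩
    · rw [h t ht]
      exact hc.congr (fun τ hτ => by rw [h τ hτ]) (by rw [h t ht])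
    · rw [h t ht]
      exact hv.congr (fun τ hτ => by rw [h τ hτ]) (by rw [h t ht])
    · rw [h t ht]
      exact hw

/-- Two transports along the same retraction curve become fields over literally the same base curve,
as `IsParallel.inner_eq` requires. Values outside `[0, 1]` are irrelevant and set to `0`. -/
theorem IsParallelTransport.exists_field {R : Retraction E M} {x : M}
    {ξ u : TangentSpace 𝓘(ℝ, E) x} {w : TangentSpace 𝓘(ℝ, E) (R x ξ)}
    (h : IsParallelTransport R x ξ u w) :
    ∃ v : ∀ t : ℝ, TangentSpace 𝓘(ℝ, E) (R x (t • ξ)),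
      (⟨_, v 0⟩ : TangentBundle 𝓘(ℝ, E) M) = ⟨x, u⟩ ∧
      (⟨_, v 1⟩ : TangentBundle 𝓘(ℝ, E) M) = ⟨R x ξ, w⟩ ∧
      IsParallel fun t => (⟨_, v t⟩ : TangentBundle 𝓘(ℝ, E) M) := by
  obtain ⟨V, hproj, h0, h1, hV⟩ := h
  have hex : ∀ t : ℝ, ∃ v : TangentSpace 𝓘(ℝ, E) (R x (t • ξ)), t ∈ Set.Icc (0 : ℝ) 1 →
      (⟨_, v⟩ : TangentBundle 𝓘(ℝ, E) M) = V t := by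
    intro t
    by_cases ht : t ∈ Set.Icc (0 : ℝ) 1
    · rw [← hproj t ht]
      exact ⟨(V t).2, fun _ => rfl⟩
    · exact ⟨0, fun h => absurd h ht⟩
  choose v hv using hex
  exact ⟨v, (hv 0 (by simp)).trans h0, (hv 1 (by simp)).trans h1, hV.congr hv⟩

/-- Parallel transport is isometric. -/
theorem IsParallelTransport.norm_sub_eq
    [IsContMDiffRiemannianBundle 𝓘(ℝ, E) ∞ E (fun x : M => TangentSpace 𝓘(ℝ, E) x)]
    {R : Retraction E M} {x : M} {ξ u u' : TangentSpace 𝓘(ℝ, E) x}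
    {w w' : TangentSpace 𝓘(ℝ, E) (R x ξ)} (h : IsParallelTransport R x ξ u w)
    (h' : IsParallelTransport R x ξ u' w') : ‖w - w'‖ = ‖u - u'‖ := by
  obtain ⟨v, h0, h1, hv⟩ := h.exists_field
  obtain ⟨v', h0', h1', hv'⟩ := h'.exists_field
  have e1 : (inner ℝ w w : ℝ) = inner ℝ u u := by
    rw [← inner_congr_of_eq h1 h1, ← inner_congr_of_eq h0 h0, hv.inner_eq hv]
  have e2 : (inner ℝ w w' : ℝ) = inner ℝ u u' := by
    rw [← inner_congr_of_eq h1 h1', ← inner_congr_of_eq h0 h0', hv.inner_eq hv']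
  have e3 : (inner ℝ w' w' : ℝ) = inner ℝ u' u' := by
    rw [← inner_congr_of_eq h1' h1', ← inner_congr_of_eq h0' h0', hv'.inner_eq hv']
  rw [real_inner_self_eq_norm_sq, real_inner_self_eq_norm_sq] at e1 e3
  rw [← sq_eq_sq₀ (norm_nonneg _) (norm_nonneg _), norm_sub_sq_real, norm_sub_sq_real, e1, e2, e3]

/-- A retraction curve that stays in a totally retractive set is shorter than the radius. -/
theorem IsTotallyRetractive.norm_lt {R : Retraction E M} {X : Set M} {δ : ℝ}
    (hX : IsTotallyRetractive R X δ) {x : M} (hx : x ∈ X) {ξ : TangentSpace 𝓘(ℝ, E) x}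
    (hξ : ∀ τ ∈ Set.Icc (0 : ℝ) 1, R x (τ • ξ) ∈ X) : ‖ξ‖ < δ := by
  obtain ⟨hδ, hR⟩ := hX
  obtain ⟨Φ, hsrc, hΦ, htgt⟩ := hR x hx
  by_contra! hle
  have hpos : 0 < ‖ξ‖ := hδ.trans_le hle
  -- `a • ξ` lies on the boundary sphere, yet `R x (a • ξ)` is still in `Φ.target`. The inverse of
  -- `Φ` is continuous there and returns `τ • ξ` for `0 < τ < a`; in the limit it returns `a • ξ`,
  -- which would then lie in the open ball.
  set a := δ / ‖ξ‖ with ha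
  have ha0 : 0 < a := div_pos hδ hpos
  have ha1 : a ≤ 1 := (div_le_one hpos).2 hle
  have hcurve : Continuous fun τ : ℝ => R x (τ • ξ) := by
    have h1 : Continuous fun v : TangentSpace 𝓘(ℝ, E) x =>
        (⟨x, v⟩ : TangentBundle 𝓘(ℝ, E) M) := FiberBundle.continuous_totalSpaceMk E _ x
    exact R.contMDiff.continuous.comp (h1.comp (continuous_id.smul continuous_const))
  have hmem : R x (a • ξ) ∈ Φ.target := htgt (hξ a ⟨ha0.le, ha1⟩)
  have hinv : ContinuousAt Φ.invFun (R x (a • ξ)) :=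
    (Φ.contMDiffOn_invFun.continuousOn).continuousAt (Φ.open_target.mem_nhds hmem)
  have hlim1 : Filter.Tendsto (fun τ : ℝ => Φ.invFun (R x (τ • ξ))) (𝓝[<] a)
      (𝓝 (Φ.invFun (R x (a • ξ)))) :=
    ((hinv.comp (f := fun τ : ℝ => R x (τ • ξ)) hcurve.continuousAt).tendsto).mono_left
      nhdsWithin_le_nhds
  have hlim2 : Filter.Tendsto (fun τ : ℝ => Φ.invFun (R x (τ • ξ))) (𝓝[<] a) (𝓝 (a • ξ)) := by
    have : Filter.Tendsto (fun τ : ℝ => τ • ξ) (𝓝[<] a) (𝓝 (a • ξ)) :=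
      ((continuous_id.smul continuous_const).tendsto a).mono_left nhdsWithin_le_nhds
    refine this.congr' ?_
    filter_upwards [Ioo_mem_nhdsLT ha0] with τ hτ
    have hb : τ • ξ ∈ Metric.ball (0 : TangentSpace 𝓘(ℝ, E) x) δ := by
      rw [mem_ball_zero_iff, norm_smul, Real.norm_of_nonneg hτ.1.le]
      exact (lt_div_iff₀ hpos).1 hτ.2
    rw [← hΦ hb]
    exact (Φ.left_inv (hsrc ▸ hb)).symm
  have heq := tendsto_nhds_unique hlim1 hlim2
  have hball : a • ξ ∈ Metric.ball (0 : TangentSpace 𝓘(ℝ, E) x) δ := by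
    rw [← hsrc, ← heq]
    exact Φ.map_target hmem
  rw [mem_ball_zero_iff, norm_smul, Real.norm_of_nonneg ha0.le, ha,
    div_mul_cancel₀ _ hpos.ne'] at hball
  exact lt_irrefl _ hball

theorem grad_objective {n : ℕ} {f : Fin n → M → ℝ}
    (hf : ∀ i, ContMDiff 𝓘(ℝ, E) 𝓘(ℝ, ℝ) 2 (f i)) (x : M) :
    grad (E := E) (objective f) x = (1 / (n : ℝ)) • ∑ i, grad (f i) x := by
  have hd (i : Fin n) : HasMFDerivAt 𝓘(ℝ, E) 𝓘(ℝ, ℝ) (f i) x (differential (E := E) (f i) x) :=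
    ((hf i x).mdifferentiableAt two_ne_zero).hasMFDerivAt
  have hsum : HasMFDerivAt 𝓘(ℝ, E) 𝓘(ℝ, ℝ) (objective f) x
      ((1 / (n : ℝ)) • ∑ i, differential (E := E) (f i) x :
        TangentSpace 𝓘(ℝ, E) x →L[ℝ] ℝ) := by
    have h := (HasMFDerivAt.sum (t := Finset.univ) fun i _ => hd i).const_smul (1 / (n : ℝ))
    have he : objective f = (1 / (n : ℝ)) • ∑ i, f i := by
      ext y
      simp [objective]
    rw [he]
    exact h
  have : differential (E := E) (objective f) x =
      (1 / (n : ℝ)) • ∑ i, differential (E := E) (f i) x := hsum.mfderiv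
  rw [grad, this, map_smulₛₗ, map_sum]
  rfl

/-- Minkowski's inequality for a quadratic mean and a constant. -/
theorem mean_add_sq_le {n : ℕ} {a : Fin n → ℝ} {A c : ℝ} (hA : 0 ≤ A) (hc : 0 ≤ c)
    (h : (1 / (n : ℝ)) * ∑ i, a i ^ 2 ≤ A ^ 2) :
    (1 / (n : ℝ)) * ∑ i, (a i + c) ^ 2 ≤ (A + c) ^ 2 := by
  rcases Nat.eq_zero_or_pos n with rfl | hn
  · simp; positivity
  have hn' : (0 : ℝ) < n := by exact_mod_cast hn
  have hmean : (1 / (n : ℝ)) * ∑ i, a i ≤ A := by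
    refine abs_le_of_sq_le_sq' ?_ hA |>.2
    refine le_trans ?_ h
    have := sq_sum_le_card_mul_sum_sq (s := Finset.univ) (f := a)
    simp only [Finset.card_univ, Fintype.card_fin] at this
    rw [mul_pow, one_div, inv_pow, sq (n : ℝ), mul_inv, mul_assoc]
    refine mul_le_mul_of_nonneg_left ?_ (by positivity)
    rwa [inv_mul_le_iff₀ hn']
  have hexp : (1 / (n : ℝ)) * ∑ i, (a i + c) ^ 2 =
      (1 / (n : ℝ)) * ∑ i, a i ^ 2 + 2 * c * ((1 / (n : ℝ)) * ∑ i, a i) + c ^ 2 := by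
    simp only [add_sq, Finset.sum_add_distrib, ← Finset.sum_mul, ← Finset.mul_sum,
      Finset.sum_const, Finset.card_univ, Fintype.card_fin, nsmul_eq_mul]
    field_simp
  rw [hexp]
  nlinarith [mul_le_mul_of_nonneg_left hmean hc]

section Assumptions

variable [IsContMDiffRiemannianBundle 𝓘(ℝ, E) ∞ E (fun x : M => TangentSpace 𝓘(ℝ, E) x)]
  {n : ℕ} {f : Fin n → M → ℝ} {R : Retraction E M} {T : VectorTransport R}
  {X : Set M} {xs : M} {δ G σ L Ll θ : ℝ}

/-- Insert the parallel transport `w` of `grad f_i(x)`. Isometry turns `‖grad f_i(y) - w‖` into the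
distance at `x` controlled by `Ll`, and `T` differs from parallel transport by at most `θ‖ξ‖G`.
Minkowski adds the two constants without loss. -/
theorem Assumptions.transport_lipschitz (hA : Assumptions f R T X xs δ G σ L Ll θ)
    (hG : 0 ≤ G) (hLl : 0 ≤ Ll) (hθ : 0 ≤ θ) {x : M} (hx : x ∈ X)
    {ξ : TangentSpace 𝓘(ℝ, E) x} (hξ : ‖ξ‖ < δ) (hy : R x ξ ∈ X) :
    (1 / (n : ℝ)) * ∑ i, ‖grad (E := E) (f i) (R x ξ) - T x ξ (grad (f i) x)‖ ^ 2 ≤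
      ((Ll + θ * G) * ‖ξ‖) ^ 2 := by
  obtain ⟨u, hu, hsum⟩ := hA.lipschitz x hx ξ hξ hy
  have hbound (i : Fin n) : ‖grad (E := E) (f i) (R x ξ) - T x ξ (grad (f i) x)‖ ≤
      ‖grad (f i) x - u i‖ + θ * ‖ξ‖ * G := by
    obtain ⟨w, hw, hTw⟩ := hA.transport x hx ξ hξ hy (grad (f i) x)
    calc _ = ‖(grad (f i) (R x ξ) - w) + (w - T x ξ (grad (f i) x))‖ := by abel_nf
      _ ≤ ‖grad (E := E) (f i) (R x ξ) - w‖ + ‖w - T x ξ (grad (f i) x)‖ := norm_add_le _ _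
      _ ≤ ‖grad (f i) x - u i‖ + θ * ‖ξ‖ * G := by
        rw [(hu i).norm_sub_eq hw, norm_sub_rev, norm_sub_rev w]
        gcongr
        exact hTw.trans (by gcongr; exact hA.gradBound x hx i)
  calc _ ≤ (1 / (n : ℝ)) * ∑ i, (‖grad (f i) x - u i‖ + θ * ‖ξ‖ * G) ^ 2 := by
        gcongr with i _
        exact hbound i
    _ ≤ (Ll * ‖ξ‖ + θ * ‖ξ‖ * G) ^ 2 :=
        mean_add_sq_le (by positivity) (by positivity) (by rwa [mul_pow])
    _ = ((Ll + θ * G) * ‖ξ‖) ^ 2 := by ring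

/-- One step of length `η` along `-v`, where `v` estimates the gradient. -/
theorem Assumptions.descent (hA : Assumptions f R T X xs δ G σ L Ll θ) {x : M} (hx : x ∈ X)
    {v : TangentSpace 𝓘(ℝ, E) x} {η : ℝ} (hξ : ‖-(η • v)‖ < δ)
    (hy : R x (-(η • v)) ∈ X) :
    objective f (R x (-(η • v))) ≤ objective f x - η / 2 * ‖grad (E := E) (objective f) x‖ ^ 2
      - η / 2 * (1 - L * η) * ‖v‖ ^ 2 + η / 2 * ‖v - grad (objective f) x‖ ^ 2 := by
  have h := hA.smooth x hx _ hξ hy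
  rw [inner_neg_right, real_inner_smul_right, norm_neg, norm_smul, mul_pow, Real.norm_eq_abs,
    sq_abs] at h
  -- Polarization: `2⟨g, v⟩ = ‖g‖² + ‖v‖² - ‖v - g‖²`.
  rw [norm_sub_sq_real, real_inner_comm]
  linarith

end Assumptions

/-! ### Sampling with and without replacement -/

/-- Redrawing a coordinate of a uniform random variable does not change its law. -/
theorem expect_resample {Ω A : Type*} [Fintype Ω] [Fintype A] [Nonempty A] (u : Ω → A → Ω)
    (c : Ω → A) (hc : ∀ d a, c (u d a) = a) (hu : ∀ d a, u (u d a) (c d) = d) (F : Ω → ℝ) :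
    𝔼 d, 𝔼 a, F (u d a) = 𝔼 d, F d := by
  have e : 𝔼 q : Ω × A, F (u q.1 q.2) = 𝔼 q : Ω × A, F q.1 := by
    -- Exchanging the fresh value with the old one is an involution, so it preserves the uniform law
    -- on `Ω × A`.
    let φ : Ω × A → Ω × A := fun q => (u q.1 q.2, c q.1)
    have hφ : Function.Involutive φ := fun q => by simp [φ, hc, hu]
    exact Fintype.expect_equiv hφ.toPerm _ _ fun q => rfl
  rw [← Finset.expect_product', Finset.univ_product_univ, e, ← Finset.univ_product_univ,
    Finset.expect_product]
  simp

theorem expect_pi_apply {b : ℕ} {A : Type*} [Fintype A] [Nonempty A] (j : Fin b) (φ : A → ℝ) :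
    𝔼 I : Fin b → A, φ (I j) = 𝔼 a, φ a := by
  classical
  rw [← expect_resample (fun (I : Fin b → A) a => Function.update I j a) (fun I => I j)
    (by simp) (by simp)]
  simp

theorem expect_perm_swap {n : ℕ} (k k' : Fin n) (F : Equiv.Perm (Fin n) → ℝ) :
    𝔼 p : Equiv.Perm (Fin n), F (p * Equiv.swap k k') = 𝔼 p : Equiv.Perm (Fin n), F p :=
  Fintype.expect_equiv (Equiv.mulRight (Equiv.swap k k')) _ _ fun _ => rfl

/-- By exchangeability every position has the same mean, and the values at all positions sum to `∑
φ` for each permutation. -/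
theorem expect_perm_apply {n : ℕ} (j : Fin n) (φ : Fin n → ℝ) :
    𝔼 p : Equiv.Perm (Fin n), φ (p j) = (1 / (n : ℝ)) * ∑ i, φ i := by
  have hn : (n : ℝ) ≠ 0 := by
    have := j.pos
    positivity
  have hall (k : Fin n) : 𝔼 p : Equiv.Perm (Fin n), φ (p k) = 𝔼 p : Equiv.Perm (Fin n), φ (p j) := by
    rw [← expect_perm_swap k j]
    simp
  have hsum : ∑ k, 𝔼 p : Equiv.Perm (Fin n), φ (p k) = ∑ i, φ i := by
    rw [← Finset.expect_sum_comm]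
    simp [Equiv.sum_comp]
  simp only [hall, Finset.sum_const, Finset.card_univ, Fintype.card_fin, nsmul_eq_mul] at hsum
  rw [← hsum]
  field_simp

section Hilbert

variable {H : Type*} [NormedAddCommGroup H] [InnerProductSpace ℝ H]

theorem norm_sum_sq_eq {ι : Type*} [Fintype ι] (z : ι → H) :
    ‖∑ j, z j‖ ^ 2 = ∑ j, ∑ k, (inner ℝ (z j) (z k) : ℝ) := by
  rw [← real_inner_self_eq_norm_sq, sum_inner]
  simp [inner_sum]

theorem sum_sub_mean_eq_zero {n : ℕ} (hn : 0 < n) (g : Fin n → H) :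
    ∑ i, (g i - (1 / (n : ℝ)) • ∑ k, g k) = 0 := by
  have hn' : (n : ℝ) ≠ 0 := by positivity
  rw [Finset.sum_sub_distrib, Finset.sum_const, Finset.card_univ, Fintype.card_fin,
    ← Nat.cast_smul_eq_nsmul ℝ, smul_smul, mul_one_div_cancel hn', one_smul, sub_self]

theorem mean_sub_eq {n b : ℕ} (hb : 0 < b) (g : Fin n → H) (c : H) (I : Fin b → Fin n) :
    (1 / (b : ℝ)) • ∑ j, g (I j) - c = (1 / (b : ℝ)) • ∑ j, (g (I j) - c) := by
  have hb' : (b : ℝ) ≠ 0 := by positivity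
  rw [Finset.sum_sub_distrib, Finset.sum_const, Finset.card_univ, Fintype.card_fin,
    ← Nat.cast_smul_eq_nsmul ℝ, smul_sub, smul_smul, one_div_mul_cancel hb', one_smul]

theorem sum_norm_sub_mean_sq_le {n : ℕ} (hn : 0 < n) (g : Fin n → H) :
    ∑ i, ‖g i - (1 / (n : ℝ)) • ∑ k, g k‖ ^ 2 ≤ ∑ i, ‖g i‖ ^ 2 := by
  set a := (1 / (n : ℝ)) • ∑ k, g k with ha
  have h (i : Fin n) : ‖g i‖ ^ 2 = ‖g i - a‖ ^ 2 + 2 * inner ℝ (g i - a) a + ‖a‖ ^ 2 := by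
    rw [← norm_add_sq_real, sub_add_cancel]
  have h0 : ∑ i, (inner ℝ (g i - a) a : ℝ) = 0 := by
    rw [← sum_inner, sum_sub_mean_eq_zero hn, inner_zero_left]
  rw [Finset.sum_congr rfl fun i _ => h i, Finset.sum_add_distrib, Finset.sum_add_distrib,
    ← Finset.mul_sum, h0]
  have : 0 ≤ ∑ _i : Fin n, ‖a‖ ^ 2 := by positivity
  linarith

/-- The second moment of a sample mean of `b` independent draws, around a fixed vector. -/
theorem expect_norm_sample_mean_sq_le {n b : ℕ} (hn : 0 < n) (hb : 0 < b) (g : Fin n → H)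
    (c : H) :
    𝔼 I : Fin b → Fin n, ‖((1 / (b : ℝ)) • ∑ j, g (I j) - (1 / (n : ℝ)) • ∑ i, g i) + c‖ ^ 2 ≤
      (1 / (b : ℝ)) * ((1 / (n : ℝ)) * ∑ i, ‖g i‖ ^ 2) + ‖c‖ ^ 2 := by
  have : Nonempty (Fin n) := ⟨⟨0, hn⟩⟩
  have hb' : (0 : ℝ) < b := by exact_mod_cast hb
  set z : Fin n → H := fun i => g i - (1 / (n : ℝ)) • ∑ i, g i with hz
  have hz0 : ∑ i, z i = 0 := sum_sub_mean_eq_zero hn g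
  have hmean (w : H) : 𝔼 i, (inner ℝ (z i) w : ℝ) = 0 := by
    rw [Fintype.expect_eq_sum_div_card, ← sum_inner, hz0, inner_zero_left, zero_div]
  have hcross : 𝔼 I : Fin b → Fin n, (inner ℝ (∑ j, z (I j)) c : ℝ) = 0 := by
    simp only [sum_inner]
    rw [Finset.expect_sum_comm]
    refine Finset.sum_eq_zero fun j _ => ?_
    rw [expect_pi_apply j fun i => (inner ℝ (z i) c : ℝ), hmean]
  have hpair (j k : Fin b) : 𝔼 I : Fin b → Fin n, (inner ℝ (z (I j)) (z (I k)) : ℝ) =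
      if j = k then (1 / (n : ℝ)) * ∑ i, ‖z i‖ ^ 2 else 0 := by
    split_ifs with hjk
    · subst hjk
      simp only [real_inner_self_eq_norm_sq]
      rw [expect_pi_apply j fun i => ‖z i‖ ^ 2, Fintype.expect_eq_sum_div_card,
        Fintype.card_fin]
      ring
    -- Independence: redraw `I j` with `I k` fixed; the centred `z` averages to zero.
    · rw [← expect_resample (fun (I : Fin b → Fin n) a => Function.update I j a) (fun I => I j)
        (by simp) (by simp)]
      simp [Function.update_of_ne (Ne.symm hjk), hmean]
  have hsq : 𝔼 I : Fin b → Fin n, ‖∑ j, z (I j)‖ ^ 2 =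
      b * ((1 / (n : ℝ)) * ∑ i, ‖z i‖ ^ 2) := by
    simp only [norm_sum_sq_eq]
    rw [Finset.expect_sum_comm]
    simp only [Finset.expect_sum_comm, hpair]
    simp
  have hexp (I : Fin b → Fin n) :
      ‖((1 / (b : ℝ)) • ∑ j, g (I j) - (1 / (n : ℝ)) • ∑ i, g i) + c‖ ^ 2 =
        (1 / (b : ℝ)) ^ 2 * ‖∑ j, z (I j)‖ ^ 2 +
          2 * (1 / (b : ℝ)) * inner ℝ (∑ j, z (I j)) c + ‖c‖ ^ 2 := by
    rw [mean_sub_eq hb, norm_add_sq_real, norm_smul, mul_pow, Real.norm_of_nonneg (by positivity),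
      real_inner_smul_left, mul_assoc 2]
  simp only [hexp, Finset.expect_add_distrib, ← Finset.mul_expect, hsq, hcross]
  rw [Fintype.expect_const, mul_zero, add_zero]
  gcongr ?_ + _
  calc (1 / (b : ℝ)) ^ 2 * (b * ((1 / (n : ℝ)) * ∑ i, ‖z i‖ ^ 2))
      = (1 / (b : ℝ)) * ((1 / (n : ℝ)) * ∑ i, ‖z i‖ ^ 2) := by field_simp
    _ ≤ _ := by
      gcongr (1 / (b : ℝ)) * ((1 / (n : ℝ)) * ?_)
      exact sum_norm_sub_mean_sq_le hn g

/-- Two different draws without replacement from a centred population are negatively correlated. -/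
theorem expect_perm_inner_nonpos {n : ℕ} {z : Fin n → H} (hz : ∑ i, z i = 0) {j k : Fin n}
    (hjk : j ≠ k) : 𝔼 p : Equiv.Perm (Fin n), (inner ℝ (z (p j)) (z (p k)) : ℝ) ≤ 0 := by
  have hall : ∀ k' ∈ Finset.univ.erase j, 𝔼 p : Equiv.Perm (Fin n),
      (inner ℝ (z (p j)) (z (p k')) : ℝ) = 𝔼 p : Equiv.Perm (Fin n),
        (inner ℝ (z (p j)) (z (p k)) : ℝ) := by
    intro k' hk'
    rw [← expect_perm_swap k' k]
    simp [Equiv.swap_apply_of_ne_of_ne (Finset.ne_of_mem_erase hk').symm hjk]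
  -- Since `z` is centred, the inner products with all other positions sum to `-‖z (p j)‖²`. By
  -- exchangeability they have equal means, so each mean is nonpositive.
  have hsum : ∑ k' ∈ Finset.univ.erase j, 𝔼 p : Equiv.Perm (Fin n),
      (inner ℝ (z (p j)) (z (p k')) : ℝ) ≤ 0 := by
    rw [← Finset.expect_sum_comm]
    refine (Finset.expect_le_expect fun p _ => ?_).trans_eq (Finset.expect_const_zero _)
    have h0 : ∑ k', (inner ℝ (z (p j)) (z (p k')) : ℝ) = 0 := by
      rw [← inner_sum, Equiv.sum_comp p z, hz, inner_zero_right]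
    rw [← Finset.add_sum_erase _ _ (Finset.mem_univ j), real_inner_self_eq_norm_sq] at h0
    nlinarith [sq_nonneg ‖z (p j)‖]
  rw [Finset.sum_congr rfl hall, Finset.sum_const, nsmul_eq_mul] at hsum
  have hcard : 0 < (Finset.univ.erase j).card :=
    Finset.card_pos.2 ⟨k, Finset.mem_erase.2 ⟨hjk.symm, Finset.mem_univ k⟩⟩
  have hcard' : (0 : ℝ) < ((Finset.univ.erase j).card : ℝ) := by exact_mod_cast hcard
  exact nonpos_of_mul_nonpos_right hsum hcard'

/-- The variance of the mean of a sample of size `B`, drawn without replacement. -/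
theorem expect_perm_norm_sample_mean_sq_le {n B : ℕ} (hB : 0 < B) (hBn : B ≤ n) (g : Fin n → H) :
    𝔼 p : Equiv.Perm (Fin n),
        ‖(1 / (B : ℝ)) • ∑ j : Fin B, g (p (Fin.castLE hBn j)) - (1 / (n : ℝ)) • ∑ i, g i‖ ^ 2 ≤
      (1 / (B : ℝ)) * ((1 / (n : ℝ)) * ∑ i, ‖g i - (1 / (n : ℝ)) • ∑ k, g k‖ ^ 2) := by
  have hB' : (0 : ℝ) < B := by exact_mod_cast hB
  set z : Fin n → H := fun i => g i - (1 / (n : ℝ)) • ∑ i, g i with hz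
  have hz0 : ∑ i, z i = 0 := sum_sub_mean_eq_zero (hB.trans_le hBn) g
  have hpair (j k : Fin B) : 𝔼 p : Equiv.Perm (Fin n),
      (inner ℝ (z (p (Fin.castLE hBn j))) (z (p (Fin.castLE hBn k))) : ℝ) ≤
        if j = k then (1 / (n : ℝ)) * ∑ i, ‖z i‖ ^ 2 else 0 := by
    split_ifs with hjk
    · subst hjk
      simp only [real_inner_self_eq_norm_sq]
      rw [expect_perm_apply _ fun i => ‖z i‖ ^ 2]
    · exact expect_perm_inner_nonpos hz0 fun h => hjk (Fin.castLE_injective hBn h)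
  have hsq : 𝔼 p : Equiv.Perm (Fin n), ‖∑ j : Fin B, z (p (Fin.castLE hBn j))‖ ^ 2 ≤
      B * ((1 / (n : ℝ)) * ∑ i, ‖z i‖ ^ 2) := by
    simp only [norm_sum_sq_eq, Finset.expect_sum_comm]
    refine (Finset.sum_le_sum fun j _ => Finset.sum_le_sum fun k _ => hpair j k).trans_eq ?_
    simp
  have hexp (p : Equiv.Perm (Fin n)) :
      ‖(1 / (B : ℝ)) • ∑ j : Fin B, g (p (Fin.castLE hBn j)) - (1 / (n : ℝ)) • ∑ i, g i‖ ^ 2 =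
        (1 / (B : ℝ)) ^ 2 * ‖∑ j : Fin B, z (p (Fin.castLE hBn j))‖ ^ 2 := by
    rw [mean_sub_eq hB g _ fun j => p (Fin.castLE hBn j), norm_smul, mul_pow,
      Real.norm_of_nonneg (by positivity)]
  simp only [hexp, ← Finset.mul_expect]
  calc _ ≤ (1 / (B : ℝ)) ^ 2 * (B * ((1 / (n : ℝ)) * ∑ i, ‖z i‖ ^ 2)) := by gcongr
    _ = (1 / (B : ℝ)) * ((1 / (n : ℝ)) * ∑ i, ‖z i‖ ^ 2) := by field_simp

end Hilbert

/-! ### One step of the algorithm -/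

/-- The squared error of `v` as an estimate of `grad f` at the base point of `z = (x, v)`. -/
def sqError {n : ℕ} (f : Fin n → M → ℝ) (z : TangentBundle 𝓘(ℝ, E) M) : ℝ :=
  ‖z.2 - grad (objective f) z.proj‖ ^ 2

theorem sampleGrad_full {n B : ℕ} (f : Fin n → M → ℝ)
    (hf : ∀ i, ContMDiff 𝓘(ℝ, E) 𝓘(ℝ, ℝ) 2 (f i)) (h : B ≤ n) (hB : B = n)
    (p : Equiv.Perm (Fin n)) (x : M) :
    sampleGrad f (fun j : Fin B => p (Fin.castLE h j)) x = grad (E := E) (objective f) x := by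
  subst hB
  rw [grad_objective hf, sampleGrad]
  congr 1
  exact Equiv.sum_comp p fun i => grad (E := E) (f i) x

section Step

variable {n : ℕ} {f : Fin n → M → ℝ} {R : Retraction E M} {T : VectorTransport R}
  {X : Set M} {xs : M} {δ G L Ll θ : ℝ} {P : Input M} {mode : Setting}

theorem Input.realBatch_pos (hσ : 0 < P.σ) (hα : 0 < P.α₁) (hcap : 0 < P.cap n mode) {β : ℝ}
    (hβ : 0 ≤ β) : 0 < P.realBatch n mode β := by
  unfold Input.realBatch
  split_ifs with h
  · exact hcap
  · have : 0 < β := lt_of_le_of_ne hβ (Ne.symm h)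
    exact lt_min (by positivity) hcap

/-- A full batch has no error. Otherwise the variance is at most `σ²/B`: if the adaptive value
`α₁σ²/β` determines `B`, then `α₁ ≥ 4` gives `β/4`; if the cap does, it is below `n` and `hcapκ`
gives `κ`. -/
theorem expect_sqError_firstPair_le (hn : 0 < n)
    (hA : Assumptions f R T X xs δ G P.σ L Ll θ) (hσ : 0 < P.σ) (hα : 4 ≤ P.α₁) {κ : ℝ}
    (hκ : 0 ≤ κ) (hcap : 0 < P.cap n mode)
    (hcapκ : (n : ℝ) ≤ P.cap n mode ∨ P.σ ^ 2 ≤ κ * P.cap n mode)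
    {x : M} (hx : x ∈ X) {β : ℝ} (hβ : 0 ≤ β) :
    𝔼 p : Equiv.Perm (Fin n), sqError f (firstPair (E := E) f P mode x β p) ≤ β / 4 + κ := by
  have hrb := Input.realBatch_pos (n := n) (mode := mode) hσ (by linarith) hcap hβ
  have hB0 : 0 < P.batch n mode β := lt_min (Nat.ceil_pos.2 hrb) hn
  have hBn : P.batch n mode β ≤ n := min_le_right _ _
  by_cases hB : P.batch n mode β = n
  · refine le_trans (le_of_eq ?_) (show (0 : ℝ) ≤ β / 4 + κ by positivity)
    refine Finset.expect_eq_zero fun p _ => ?_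
    have h0 := sub_eq_zero.2 (sampleGrad_full f hA.contMDiff hBn hB p x)
    have h1 : sqError f (firstPair (E := E) f P mode x β p) =
        ‖(0 : TangentSpace 𝓘(ℝ, E) x)‖ ^ 2 :=
      congrArg (fun w : TangentSpace 𝓘(ℝ, E) x => ‖w‖ ^ 2) h0
    rw [h1, norm_zero, zero_pow two_ne_zero]
  have hlt : ⌈P.realBatch n mode β⌉₊ < n := by
    by_contra! hge
    exact hB (min_eq_right hge)
  have hBeq : P.batch n mode β = ⌈P.realBatch n mode β⌉₊ := min_eq_left hlt.le
  have hrbB : P.realBatch n mode β ≤ (P.batch n mode β : ℝ) := hBeq ▸ Nat.le_ceil _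
  have hrbn : P.realBatch n mode β < n := (Nat.lt_of_ceil_lt hlt)
  have hcapβ (h : P.cap n mode < n) : P.σ ^ 2 ≤ (β / 4 + κ) * P.cap n mode :=
    (hcapκ.resolve_left h.not_ge).trans (by gcongr; linarith)
  have hmain : P.σ ^ 2 ≤ (β / 4 + κ) * P.realBatch n mode β := by
    unfold Input.realBatch at hrbn ⊢
    split_ifs at hrbn ⊢ with h
    · exact hcapβ hrbn
    · have hβ' : 0 < β := lt_of_le_of_ne hβ (Ne.symm h)
      rcases min_choice (P.α₁ * P.σ ^ 2 / β) (P.cap n mode) with hm | hm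
      · rw [hm]
        calc P.σ ^ 2 = β / 4 * (4 * P.σ ^ 2 / β) := by field_simp
          _ ≤ (β / 4 + κ) * (P.α₁ * P.σ ^ 2 / β) := by gcongr; linarith
      · rw [hm] at hrbn ⊢
        exact hcapβ hrbn
  have hvar := expect_perm_norm_sample_mean_sq_le hB0 hBn fun i => grad (E := E) (f i) x
  rw [← grad_objective hA.contMDiff] at hvar
  refine le_trans hvar ?_
  rw [one_div_mul_eq_div, div_le_iff₀ (by exact_mod_cast hB0)]
  exact (hA.variance x hx).trans (hmain.trans (by gcongr))

variable [IsContMDiffRiemannianBundle 𝓘(ℝ, E) ∞ E (fun x : M => TangentSpace 𝓘(ℝ, E) x)]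

/-- The recursive estimator carries the old error along by `T`, an isometry, and adds independent
centred noise, whose variance is the transported Lipschitz bound divided by `b`. -/
theorem expect_sqError_nextPair_le (hn : 0 < n) (hb : 0 < P.b)
    (hA : Assumptions f R T X xs δ G P.σ L Ll θ) (hG : 0 ≤ G) (hLl : 0 ≤ Ll) (hθ : 0 ≤ θ)
    {z : TangentBundle 𝓘(ℝ, E) M} (hz : z.proj ∈ X) (hξ : ‖-(P.η • z.2)‖ < δ)
    (hy : move R P z ∈ X) :
    𝔼 I : Fin P.b → Fin n, sqError f (nextPair f R T P I z) ≤
      sqError f z + ((Ll + θ * G) * P.η) ^ 2 / P.b * ‖z.2‖ ^ 2 := by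
  obtain ⟨x, v⟩ := z
  set ξ : TangentSpace 𝓘(ℝ, E) x := -(P.η • v) with hξdef
  have hlip := hA.transport_lipschitz hG hLl hθ hz hξ hy
  have hvar := expect_norm_sample_mean_sq_le hn hb
    (fun i => grad (E := E) (f i) (R x ξ) - T x ξ (grad (f i) x))
    (T x ξ (v - grad (objective f) x))
  have heq (I : Fin P.b → Fin n) : sqError f (nextPair f R T P I ⟨x, v⟩) =
      ‖((1 / (P.b : ℝ)) • ∑ j, (grad (E := E) (f (I j)) (R x ξ) - T x ξ (grad (f (I j)) x)) -
        (1 / (n : ℝ)) • ∑ i, (grad (E := E) (f i) (R x ξ) - T x ξ (grad (f i) x))) +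
        T x ξ (v - grad (objective f) x)‖ ^ 2 := by
    have h1 : sampleGrad f I (R x ξ) - T x ξ (sampleGrad f I x - v) - grad (objective f) (R x ξ) =
        ((1 / (P.b : ℝ)) • ∑ j, (grad (E := E) (f (I j)) (R x ξ) - T x ξ (grad (f (I j)) x)) -
        (1 / (n : ℝ)) • ∑ i, (grad (E := E) (f i) (R x ξ) - T x ξ (grad (f i) x))) +
        T x ξ (v - grad (objective f) x) := by
      simp only [grad_objective hA.contMDiff, sampleGrad, map_sub, map_smul, map_sum,
        Finset.sum_sub_distrib, smul_sub]
      abel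
    exact congrArg (fun w => ‖w‖ ^ 2) h1
  simp only [heq]
  refine hvar.trans ?_
  rw [LinearIsometry.norm_map, add_comm]
  refine add_le_add le_rfl ?_
  refine (mul_le_mul_of_nonneg_left hlip (by positivity)).trans_eq ?_
  rw [hξdef, norm_neg, norm_smul, Real.norm_eq_abs, mul_pow, mul_pow, sq_abs]
  ring

end Step

/-! ### Dependence of the iterates on the draws -/

section Run

variable {n : ℕ} (f : Fin n → M → ℝ) (R : Retraction E M) (T : VectorTransport R)
  (P : Input M) (mode : Setting)

/-- The iterates are adapted: this and `innerPair_congr` allow a draw to be redrawn without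
disturbing what precedes it, which replaces conditional expectations. -/
theorem epochStart_congr {d d' : Draws n P.S P.m P.b} {k : ℕ}
    (h : ∀ s : Fin P.S, (s : ℕ) < k → d s = d' s) :
    epochStart f R T P mode d k = epochStart f R T P mode d' k := by
  induction k with
  | zero => rfl
  | succ k ih =>
    have ih' := ih fun s hs => h s (hs.trans k.lt_succ_self)
    simp only [epochStart]
    rw [ih']
    split_ifs with hk
    · rw [h ⟨k, hk⟩ k.lt_succ_self]
    · rfl

theorem innerPair_congr (x : M) (β : ℝ)
    {e e' : Equiv.Perm (Fin n) × (Fin (P.m - 1) → Fin P.b → Fin n)} {t : ℕ} (h1 : e.1 = e'.1)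
    (h2 : ∀ j : Fin (P.m - 1), (j : ℕ) < t → e.2 j = e'.2 j) :
    innerPair f R T P mode x β e t = innerPair f R T P mode x β e' t := by
  induction t with
  | zero => simp only [innerPair, h1]
  | succ t ih =>
    have ih' := ih fun s hs => h2 s (hs.trans t.lt_succ_self)
    simp only [innerPair, ih']
    split_ifs with ht
    · rw [h2 ⟨t, ht⟩ t.lt_succ_self]
    · rfl

/-- The pair `(x_t, v_t)` of epoch `s`. -/
def runPair (d : Draws n P.S P.m P.b) (s : Fin P.S) (t : ℕ) : TangentBundle 𝓘(ℝ, E) M :=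
  innerPair f R T P mode (epochStart f R T P mode d s).1 (epochStart f R T P mode d s).2 (d s) t

theorem epochStart_update (d : Draws n P.S P.m P.b) (s : Fin P.S)
    (e : Equiv.Perm (Fin n) × (Fin (P.m - 1) → Fin P.b → Fin n)) :
    epochStart f R T P mode (Function.update d s e) s = epochStart f R T P mode d s :=
  epochStart_congr f R T P mode fun _ hs =>
    Function.update_of_ne (fun h => hs.ne (congrArg Fin.val h)) _ _

theorem runPair_update_zero (d : Draws n P.S P.m P.b) (s : Fin P.S) (p : Equiv.Perm (Fin n)) :
    runPair f R T P mode (Function.update d s (p, (d s).2)) s 0 =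
      firstPair f P mode (epochStart f R T P mode d s).1 (epochStart f R T P mode d s).2 p := by
  simp only [runPair, epochStart_update, Function.update_self, innerPair]

theorem runPair_update_succ (d : Draws n P.S P.m P.b) (s : Fin P.S) {t : ℕ} (ht : t < P.m - 1)
    (I : Fin P.b → Fin n) :
    runPair f R T P mode
        (Function.update d s ((d s).1, Function.update (d s).2 ⟨t, ht⟩ I)) s (t + 1) =
      nextPair f R T P I (runPair f R T P mode d s t) := by
  simp only [runPair, epochStart_update, Function.update_self, innerPair, dif_pos ht]
  congr 1
  refine innerPair_congr f R T P mode _ _ rfl fun j hj => ?_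
  exact Function.update_of_ne (fun h => hj.ne (congrArg Fin.val h)) _ _

theorem runPair_succ_proj (d : Draws n P.S P.m P.b) (s : Fin P.S) {t : ℕ} (ht : t < P.m - 1) :
    (runPair f R T P mode d s (t + 1)).proj = move R P (runPair f R T P mode d s t) := by
  simp only [runPair, innerPair, dif_pos ht, nextPair]

theorem epochStart_succ (d : Draws n P.S P.m P.b) (s : Fin P.S) :
    epochStart f R T P mode d (s + 1) = (move R P (runPair f R T P mode d s (P.m - 1)),
      ∑ t ∈ Finset.range P.m, ‖(runPair f R T P mode d s t).2‖ ^ 2 / P.m) := by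
  simp only [epochStart, dif_pos s.2]
  rfl

theorem epochStart_snd_nonneg (hβ : 0 ≤ P.β₁) (d : Draws n P.S P.m P.b) (k : ℕ) :
    0 ≤ (epochStart f R T P mode d k).2 := by
  induction k with
  | zero => exact hβ
  | succ k ih =>
    simp only [epochStart]
    split_ifs
    · positivity
    · exact ih

end Run

/-! ### The expected gradient norm -/

/-- Each `q t` enters at most `m` of the errors, which cancels the factor `1 / m` gained from
mini-batches of size `m`. -/
theorem sum_le_of_succ_le {m : ℕ} {e q : ℕ → ℝ} {a : ℝ} (ha : 0 ≤ a) (hq : ∀ t, 0 ≤ q t)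
    (h : ∀ t, t + 1 < m → e (t + 1) ≤ e t + a / m * q t) :
    ∑ t ∈ Finset.range m, e t ≤ m * e 0 + a * ∑ t ∈ Finset.range m, q t := by
  have hle : ∀ t, t < m → e t ≤ e 0 + a / m * ∑ j ∈ Finset.range t, q j := by
    intro t
    induction t with
    | zero => simp
    | succ t ih =>
      intro ht
      rw [Finset.sum_range_succ, mul_add]
      linarith [h t ht, ih (t.lt_succ_self.trans ht)]
  have hle' : ∀ t ∈ Finset.range m, e t ≤ e 0 + a / m * ∑ j ∈ Finset.range m, q j := by
    intro t ht
    refine (hle t (Finset.mem_range.1 ht)).trans ?_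
    gcongr
    · exact fun j _ _ => hq j
    · exact (Finset.mem_range.1 ht).le
  refine (Finset.sum_le_sum hle').trans ?_
  rcases Nat.eq_zero_or_pos m with rfl | hm
  · simp
  · rw [Finset.sum_const, Finset.card_range, nsmul_eq_mul, mul_add]
    have : (m : ℝ) ≠ 0 := by positivity
    refine le_of_eq ?_
    field_simp

theorem stepSize_pos {L Ll θ G : ℝ} (hL : 0 < L) : 0 < stepSize L Ll θ G := by
  unfold stepSize
  positivity

theorem stepSize_mul_Theta {L Ll θ G : ℝ} (hL : 0 < L) :
    stepSize L Ll θ G * Theta 3 L Ll θ G = 3 / 2 := by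
  unfold stepSize Theta
  have : 0 ≤ √(L ^ 2 + 3 * (Ll + θ * G) ^ 2) := Real.sqrt_nonneg _
  field_simp

/-- The step size is the positive root of this quadratic, with the denominator rationalized. The
value `3/4` leaves `1/4` of the `‖v_t‖²` term, just what the potential needs. -/
theorem stepSize_root {L Ll θ G : ℝ} (hL : 0 < L) :
    L * stepSize L Ll θ G + ((Ll + θ * G) * stepSize L Ll θ G) ^ 2 = 3 / 4 := by
  have hr : 0 ≤ √(L ^ 2 + 3 * (Ll + θ * G) ^ 2) := Real.sqrt_nonneg _
  have hsq : √(L ^ 2 + 3 * (Ll + θ * G) ^ 2) ^ 2 = L ^ 2 + 3 * (Ll + θ * G) ^ 2 :=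
    Real.sq_sqrt (by positivity)
  unfold stepSize
  set r := √(L ^ 2 + 3 * (Ll + θ * G) ^ 2)
  have h2 : (2 * L + 2 * r) ≠ 0 := by positivity
  field_simp
  nlinarith

theorem sq_expect_le {ι : Type*} [Fintype ι] [Nonempty ι] (a : ι → ℝ) :
    (𝔼 i, a i) ^ 2 ≤ 𝔼 i, a i ^ 2 := by
  have hc : (0 : ℝ) < Fintype.card ι := by exact_mod_cast Fintype.card_pos
  have := sq_sum_le_card_mul_sum_sq (s := Finset.univ) (f := a)
  rw [Fintype.expect_eq_sum_div_card, Fintype.expect_eq_sum_div_card, div_pow,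
    div_le_div_iff₀ (by positivity) hc]
  rw [Finset.card_univ] at this
  nlinarith

section Main

variable {n : ℕ} {f : Fin n → M → ℝ} {R : Retraction E M} {T : VectorTransport R}
  {X : Set M} {xs : M} {δ G L Ll θ : ℝ} {P : Input M} {mode : Setting}

theorem StaysIn.step (h : StaysIn f R T P mode X) (hX : IsTotallyRetractive R X δ)
    (d : Draws n P.S P.m P.b) (s : Fin P.S) {t : ℕ} (ht : t < P.m) :
    (runPair f R T P mode d s t).proj ∈ X ∧
      ‖-(P.η • (runPair f R T P mode d s t).2)‖ < δ ∧
      move R P (runPair f R T P mode d s t) ∈ X := by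
  have h' : ∀ τ ∈ Set.Icc (0 : ℝ) 1, R (runPair f R T P mode d s t).proj
      (-(τ • P.η • (runPair f R T P mode d s t).2)) ∈ X := h d s ⟨t, ht⟩
  have hx : (runPair f R T P mode d s t).proj ∈ X := by
    have := h' 0 (by simp)
    rwa [zero_smul, neg_zero, R.map_zero] at this
  refine ⟨hx, hX.norm_lt hx fun τ hτ => ?_, ?_⟩
  · rw [smul_neg]
    exact h' τ hτ
  · have := h' 1 (by simp)
    rwa [one_smul] at this

variable [IsContMDiffRiemannianBundle 𝓘(ℝ, E) ∞ E (fun x : M => TangentSpace 𝓘(ℝ, E) x)]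

theorem objective_epochStart_succ_le (hA : Assumptions f R T X xs δ G P.σ L Ll θ)
    (hstay : StaysIn f R T P mode X) (hm : 0 < P.m) (d : Draws n P.S P.m P.b) (s : Fin P.S) :
    objective f (epochStart f R T P mode d (s + 1)).1 ≤ objective f (epochStart f R T P mode d s).1 -
      (P.η / 2 * ∑ t ∈ Finset.range P.m,
          ‖grad (E := E) (objective f) (runPair f R T P mode d s t).proj‖ ^ 2 +
        P.η / 2 * (1 - L * P.η) *
          ∑ t ∈ Finset.range P.m, ‖(runPair f R T P mode d s t).2‖ ^ 2 -
        P.η / 2 * ∑ t ∈ Finset.range P.m, sqError f (runPair f R T P mode d s t)) := by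
  have hstep {t : ℕ} (ht : t < P.m) := hstay.step hA.retractive d s ht
  have key : ∀ k, k < P.m → objective f (move R P (runPair f R T P mode d s k)) ≤
      objective f (epochStart f R T P mode d s).1 - ∑ t ∈ Finset.range (k + 1),
        (P.η / 2 * ‖grad (E := E) (objective f) (runPair f R T P mode d s t).proj‖ ^ 2 +
          P.η / 2 * (1 - L * P.η) * ‖(runPair f R T P mode d s t).2‖ ^ 2 -
          P.η / 2 * sqError f (runPair f R T P mode d s t)) := by
    intro k
    induction k with
    | zero =>
      intro hk
      obtain ⟨h1, h2, h3⟩ := hstep hk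
      have := hA.descent h1 h2 h3
      rw [Finset.sum_range_one, sqError]
      change _ ≤ objective f (runPair f R T P mode d s 0).proj - _
      unfold move
      linarith
    | succ k ih =>
      intro hk
      obtain ⟨h1, h2, h3⟩ := hstep hk
      have h4 := hA.descent h1 h2 h3
      have h5 := ih (k.lt_succ_self.trans hk)
      have h6 : objective f (runPair f R T P mode d s (k + 1)).proj =
          objective f (move R P (runPair f R T P mode d s k)) :=
        congrArg _ (runPair_succ_proj f R T P mode d s (by omega))
      rw [Finset.sum_range_succ, sqError]
      unfold move at h5 h6 ⊢
      linarith
  have := key (P.m - 1) (by omega)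
  rw [Nat.sub_add_cancel hm, Finset.sum_sub_distrib, Finset.sum_add_distrib, ← Finset.mul_sum,
    ← Finset.mul_sum, ← Finset.mul_sum] at this
  rw [epochStart_succ]
  exact this

theorem expect_sum_sqError_le (hn : 0 < n) (hm : 0 < P.m) (hb : P.b = P.m)
    (hA : Assumptions f R T X xs δ G P.σ L Ll θ) (hG : 0 ≤ G) (hLl : 0 ≤ Ll) (hθ : 0 ≤ θ)
    (hσ : 0 < P.σ) (hα : 4 ≤ P.α₁) (hβ : 0 ≤ P.β₁) {κ : ℝ} (hκ : 0 ≤ κ)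
    (hcap : 0 < P.cap n mode) (hcapκ : (n : ℝ) ≤ P.cap n mode ∨ P.σ ^ 2 ≤ κ * P.cap n mode)
    (hstay : StaysIn f R T P mode X) (s : Fin P.S) :
    𝔼 d : Draws n P.S P.m P.b, ∑ t ∈ Finset.range P.m, sqError f (runPair f R T P mode d s t) ≤
      P.m * (𝔼 d : Draws n P.S P.m P.b, (epochStart f R T P mode d s).2 / 4 + κ) +
        ((Ll + θ * G) * P.η) ^ 2 * 𝔼 d : Draws n P.S P.m P.b,
          ∑ t ∈ Finset.range P.m, ‖(runPair f R T P mode d s t).2‖ ^ 2 := by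
  have : Nonempty (Fin n) := ⟨⟨0, hn⟩⟩
  have hzero : 𝔼 d : Draws n P.S P.m P.b, sqError f (runPair f R T P mode d s 0) ≤
      𝔼 d : Draws n P.S P.m P.b, (epochStart f R T P mode d s).2 / 4 + κ := by
    -- Average first over the permutation of epoch `s`; its starting point and `β` do not depend on
    -- it.
    rw [← expect_resample (fun (d : Draws n P.S P.m P.b) p => Function.update d s (p, (d s).2))
      (fun d => (d s).1) (by simp) (by simp)]
    have hκ' : 𝔼 _d : Draws n P.S P.m P.b, κ = κ := Fintype.expect_const κ
    conv_rhs => rw [← hκ', ← Finset.expect_add_distrib]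
    refine Finset.expect_le_expect fun d _ => ?_
    simp only [runPair_update_zero]
    exact expect_sqError_firstPair_le hn hA hσ hα hκ hcap hcapκ
      (hstay.step hA.retractive d s hm).1 (epochStart_snd_nonneg f R T P mode hβ d s)
  have hsucc (t : ℕ) (ht : t + 1 < P.m) :
      𝔼 d : Draws n P.S P.m P.b, sqError f (runPair f R T P mode d s (t + 1)) ≤
        𝔼 d : Draws n P.S P.m P.b, sqError f (runPair f R T P mode d s t) +
        ((Ll + θ * G) * P.η) ^ 2 / P.m *
          𝔼 d : Draws n P.S P.m P.b, ‖(runPair f R T P mode d s t).2‖ ^ 2 := by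
    have ht' : t < P.m - 1 := by omega
    -- Average first over the mini-batch that produces `v_{t+1}`; the pair at time `t` does not
    -- depend on it.
    rw [← expect_resample (fun (d : Draws n P.S P.m P.b) I =>
        Function.update d s ((d s).1, Function.update (d s).2 ⟨t, ht'⟩ I))
      (fun d => (d s).2 ⟨t, ht'⟩) (by simp) (by simp), Finset.mul_expect,
      ← Finset.expect_add_distrib]
    refine Finset.expect_le_expect fun d _ => ?_
    simp only [runPair_update_succ]
    obtain ⟨h1, h2, h3⟩ := hstay.step hA.retractive d s (t.lt_succ_self.trans ht)
    have h4 := expect_sqError_nextPair_le hn (hb ▸ hm) hA hG hLl hθ h1 h2 h3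
    rwa [show (P.b : ℝ) = P.m from congrArg _ hb] at h4
  rw [Finset.expect_sum_comm, Finset.expect_sum_comm]
  refine (sum_le_of_succ_le (sq_nonneg _) (fun t => ?_) hsucc).trans ?_
  · exact Finset.expect_nonneg fun d _ => sq_nonneg _
  · gcongr

/-- The potential `f(x̃^s) + (ηm/8) β_s` decreases in expectation, up to the variance of capped
batches. -/
theorem expect_potential_succ_le (hn : 0 < n) (hm : 0 < P.m) (hb : P.b = P.m)
    (hA : Assumptions f R T X xs δ G P.σ L Ll θ) (hG : 0 ≤ G) (hL : 0 < L) (hLl : 0 ≤ Ll)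
    (hθ : 0 ≤ θ) (hη : P.η = stepSize L Ll θ G)
    (hσ : 0 < P.σ) (hα : 4 ≤ P.α₁) (hβ : 0 ≤ P.β₁) {κ : ℝ} (hκ : 0 ≤ κ)
    (hcap : 0 < P.cap n mode) (hcapκ : (n : ℝ) ≤ P.cap n mode ∨ P.σ ^ 2 ≤ κ * P.cap n mode)
    (hstay : StaysIn f R T P mode X) (s : Fin P.S) :
    𝔼 d : Draws n P.S P.m P.b, objective f (epochStart f R T P mode d (s + 1)).1 +
        P.η * P.m / 8 * 𝔼 d : Draws n P.S P.m P.b, (epochStart f R T P mode d (s + 1)).2 ≤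
      𝔼 d : Draws n P.S P.m P.b, objective f (epochStart f R T P mode d s).1 +
        P.η * P.m / 8 * 𝔼 d : Draws n P.S P.m P.b, (epochStart f R T P mode d s).2 -
        P.η / 2 * 𝔼 d : Draws n P.S P.m P.b, ∑ t ∈ Finset.range P.m,
          ‖grad (E := E) (objective f) (runPair f R T P mode d s t).proj‖ ^ 2 +
        P.η * P.m * κ / 2 := by
  have hη0 : 0 < P.η := hη ▸ stepSize_pos hL
  have hm' : (0 : ℝ) < P.m := by exact_mod_cast hm
  have hroot : L * P.η + ((Ll + θ * G) * P.η) ^ 2 = 3 / 4 := hη ▸ stepSize_root hL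
  have herr := expect_sum_sqError_le hn hm hb hA hG hLl hθ hσ hα hβ hκ hcap hcapκ hstay s
  have hdesc := Finset.expect_le_expect (s := Finset.univ) fun d _ =>
    objective_epochStart_succ_le hA hstay hm d s
  simp only [Finset.expect_sub_distrib, Finset.expect_add_distrib, ← Finset.mul_expect] at hdesc
  rw [← Finset.expect_div] at herr
  have hβ' : 𝔼 d : Draws n P.S P.m P.b, (epochStart f R T P mode d (s + 1)).2 =
      (𝔼 d : Draws n P.S P.m P.b,
        ∑ t ∈ Finset.range P.m, ‖(runPair f R T P mode d s t).2‖ ^ 2) / P.m := by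
    rw [Finset.expect_div]
    refine Finset.expect_congr rfl fun d _ => ?_
    rw [epochStart_succ, Finset.sum_div]
  rw [hβ']
  set Q := 𝔼 d : Draws n P.S P.m P.b,
    ∑ t ∈ Finset.range P.m, ‖(runPair f R T P mode d s t).2‖ ^ 2
  have hQ : P.η * P.m / 8 * (Q / P.m) = P.η / 8 * Q := by field_simp
  rw [hQ]
  have hmul := mul_le_mul_of_nonneg_left herr (half_pos hη0).le
  have hcoef : P.η / 2 * (1 - L * P.η) * Q - P.η / 2 * (((Ll + θ * G) * P.η) ^ 2 * Q) =
      P.η / 8 * Q := by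
    rw [show ((Ll + θ * G) * P.η) ^ 2 = 3 / 4 - L * P.η by linarith]
    ring
  linarith

/-- After telescoping, the mean squared gradient is at most `2Δ/(ηmS) + β₁/(4S) + ε²/4`. The choice
of `S` bounds the first term by `ε²/2`, and `β₁ ≤ ε²S` the second by `ε²/4`. -/
theorem expectedGradNorm_le (hn : 0 < n) (hm : 0 < P.m) (hb : P.b = P.m)
    (hA : Assumptions f R T X xs δ G P.σ L Ll θ) (hG : 0 ≤ G) (hL : 0 < L) (hLl : 0 ≤ Ll)
    (hθ : 0 ≤ θ) (hη : P.η = stepSize L Ll θ G) (hε : 0 < P.ε)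
    (hσ : 0 < P.σ) (hα : 4 ≤ P.α₁) (hβ : 0 ≤ P.β₁) (hβS : P.β₁ ≤ P.ε ^ 2 * P.S)
    (hΔ : 0 < objective f P.x₀ - objective f xs)
    (hS : P.S = ⌈4 * (objective f P.x₀ - objective f xs) / (P.m * P.η * P.ε ^ 2)⌉₊)
    (hcap : 0 < P.cap n mode)
    (hcapκ : (n : ℝ) ≤ P.cap n mode ∨ P.σ ^ 2 ≤ P.ε ^ 2 / 4 * P.cap n mode)
    (hstay : StaysIn f R T P mode X) : expectedGradNorm f R T P mode ≤ P.ε := by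
  have hη0 : 0 < P.η := hη ▸ stepSize_pos hL
  have hm' : (0 : ℝ) < P.m := by exact_mod_cast hm
  have : Nonempty (Fin n) := ⟨⟨0, hn⟩⟩
  have hS0 : 0 < P.S := by
    rw [hS, Nat.ceil_pos]
    positivity
  have hS0' : (0 : ℝ) < P.S := by exact_mod_cast hS0
  have hSle : 4 * (objective f P.x₀ - objective f xs) / (P.m * P.η * P.ε ^ 2) ≤ P.S := by
    conv_rhs => rw [hS]
    exact Nat.le_ceil _
  have : Nonempty (Fin P.S) := ⟨⟨0, hS0⟩⟩
  have : Nonempty (Fin P.m) := ⟨⟨0, hm⟩⟩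
  let Φ : ℕ → ℝ := fun k =>
    𝔼 d : Draws n P.S P.m P.b, objective f (epochStart f R T P mode d k).1 +
      P.η * P.m / 8 * 𝔼 d : Draws n P.S P.m P.b, (epochStart f R T P mode d k).2
  let Γ : Fin P.S → ℝ := fun s => 𝔼 d : Draws n P.S P.m P.b, ∑ t ∈ Finset.range P.m,
    ‖grad (E := E) (objective f) (runPair f R T P mode d s t).proj‖ ^ 2
  have hΦ0 : Φ 0 = objective f P.x₀ + P.η * P.m / 8 * P.β₁ := by
    simp [Φ, epochStart]
  have hΦS : objective f xs ≤ Φ P.S := by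
    have h1 : objective f xs ≤
        𝔼 d : Draws n P.S P.m P.b, objective f (epochStart f R T P mode d P.S).1 := by
      refine Finset.le_expect Finset.univ_nonempty fun d _ => hA.isMinOn ?_
      have := (hstay.step hA.retractive d ⟨P.S - 1, by omega⟩ (t := P.m - 1) (by omega)).2.2
      have he := epochStart_succ f R T P mode d ⟨P.S - 1, by omega⟩
      rw [Nat.sub_add_cancel hS0] at he
      rw [he]
      exact this
    have h2 : 0 ≤ 𝔼 d : Draws n P.S P.m P.b, (epochStart f R T P mode d P.S).2 :=
      Finset.expect_nonneg fun d _ => epochStart_snd_nonneg f R T P mode hβ d P.S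
    have : 0 ≤ P.η * P.m / 8 * 𝔼 d : Draws n P.S P.m P.b, (epochStart f R T P mode d P.S).2 := by
      positivity
    exact h1.trans (le_add_of_nonneg_right this)
  have hsum : P.η / 2 * ∑ s, Γ s ≤ Φ 0 - Φ P.S + P.S * (P.η * P.m * (P.ε ^ 2 / 4) / 2) := by
    have h1 : ∑ s : Fin P.S, P.η / 2 * Γ s ≤
        ∑ s : Fin P.S, ((Φ s - Φ (s + 1)) + P.η * P.m * (P.ε ^ 2 / 4) / 2) := by
      refine Finset.sum_le_sum fun s _ => ?_
      have := expect_potential_succ_le hn hm hb hA hG hL hLl hθ hη hσ hα hβ (by positivity) hcap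
        hcapκ hstay s
      simp only [Φ, Γ]
      linarith
    rw [← Finset.mul_sum] at h1
    rw [Finset.sum_add_distrib, Fin.sum_univ_eq_sum_range (fun k => Φ k - Φ (k + 1)),
      Finset.sum_range_sub', Finset.sum_const, Finset.card_univ, Fintype.card_fin,
      nsmul_eq_mul] at h1
    exact h1
  have hmean : 𝔼 o : Draws n P.S P.m P.b × Fin P.S × Fin P.m,
      ‖grad (E := E) (objective f) (pair f R T P mode o.1 o.2.1 o.2.2).proj‖ ^ 2 =
        (∑ s, Γ s) / (P.S * P.m) := by
    rw [← Finset.univ_product_univ, Finset.expect_product]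
    simp only [← Finset.univ_product_univ, Finset.expect_product]
    simp only [Γ]
    rw [← Finset.expect_sum_comm, Finset.expect_div]
    refine Finset.expect_congr rfl fun d _ => ?_
    rw [Fintype.expect_eq_sum_div_card, Fintype.card_fin, mul_comm (P.S : ℝ), ← div_div]
    congr 1
    rw [Finset.sum_div]
    refine Finset.sum_congr rfl fun s _ => ?_
    rw [Fintype.expect_eq_sum_div_card, Fintype.card_fin, ← Fin.sum_univ_eq_sum_range
      (fun t => ‖grad (E := E) (objective f) (runPair f R T P mode d s t).proj‖ ^ 2)]
    rfl
  have hbound : (∑ s, Γ s) / (P.S * P.m) ≤ P.ε ^ 2 := by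
    rw [div_le_iff₀ (by positivity)]
    rw [div_le_iff₀ (by positivity)] at hSle
    have hβm : P.η * P.m / 8 * P.β₁ ≤ P.η * P.m / 8 * (P.ε ^ 2 * P.S) := by gcongr
    have : P.η / 2 * ∑ s, Γ s ≤ P.η / 2 * (P.ε ^ 2 * (P.S * P.m)) := by
      rw [hΦ0] at hsum
      linarith
    exact le_of_mul_le_mul_left this (by positivity)
  have hjensen := sq_expect_le fun o : Draws n P.S P.m P.b × Fin P.S × Fin P.m =>
      ‖grad (E := E) (objective f) (pair f R T P mode o.1 o.2.1 o.2.2).proj‖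
  rw [hmean] at hjensen
  exact (abs_le_of_sq_le_sq' (hjensen.trans hbound) hε.le).2

end Main

/-! ### The oracle complexity -/

section Complexity

variable {n : ℕ} {f : Fin n → M → ℝ} {R : Retraction E M} {T : VectorTransport R}
  {P : Input M} {mode : Setting}

theorem avgBatch_nonneg (hσ : 0 < P.σ) (hα : 0 < P.α₁) (hβ : 0 ≤ P.β₁)
    (hcap : 0 < P.cap n mode) (d : Draws n P.S P.m P.b) : 0 ≤ avgBatch f R T P mode d :=
  mul_nonneg (by positivity) (Finset.sum_nonneg fun s _ =>
    (Input.realBatch_pos hσ hα hcap (epochStart_snd_nonneg f R T P mode hβ d s)).le)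

theorem ifoCalls_le_avgBatch (hm : 0 < P.m) (hb : P.b = P.m) (hS : 0 < P.S) (hσ : 0 < P.σ)
    (hα : 0 < P.α₁) (hβ : 0 ≤ P.β₁) (hcap : 0 < P.cap n mode) (d : Draws n P.S P.m P.b) :
    (ifoCalls f R T P mode d : ℝ) ≤ P.S * avgBatch f R T P mode d + 2 * (P.S * P.m ^ 2) := by
  have hm1 : (1 : ℝ) ≤ P.m := by exact_mod_cast hm
  have hS' : (P.S : ℝ) ≠ 0 := by positivity
  have hcast : ((P.m - 1 : ℕ) : ℝ) = P.m - 1 := by rw [Nat.cast_sub hm, Nat.cast_one]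
  have hepoch (s : Fin P.S) : ((P.batch n mode (epochStart f R T P mode d s).2 +
      (P.m - 1) * (2 * P.b) : ℕ) : ℝ) ≤
        P.realBatch n mode (epochStart f R T P mode d s).2 + 2 * P.m ^ 2 := by
    have h1 : (P.batch n mode (epochStart f R T P mode d s).2 : ℝ) ≤
        ⌈P.realBatch n mode (epochStart f R T P mode d s).2⌉₊ := by
      exact_mod_cast min_le_left _ _
    have h2 := Nat.ceil_lt_add_one
      (Input.realBatch_pos (n := n) (mode := mode) hσ hα hcap
        (epochStart_snd_nonneg f R T P mode hβ d s)).le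
    push_cast
    rw [hcast, hb]
    -- Rounding the batch up costs less than `1`, absorbed by `2m(m - 1) + 1 ≤ 2m²`.
    nlinarith
  unfold ifoCalls avgBatch
  rw [Nat.cast_sum]
  refine (Finset.sum_le_sum fun s _ => hepoch s).trans_eq ?_
  rw [Finset.sum_add_distrib, Finset.sum_const, Finset.card_univ, Fintype.card_fin, nsmul_eq_mul]
  field_simp

theorem half_le_floor {K : ℝ} (hK : 1 ≤ K) : K / 2 ≤ ⌊K⌋₊ := by
  have h1 : (1 : ℝ) ≤ ⌊K⌋₊ := by exact_mod_cast (Nat.one_le_floor_iff K).2 hK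
  linarith [Nat.lt_floor_add_one K]

/-- Both settings at once, with `K = √n` or `K = σ/ε`. The hypothesis `h1` makes rounding `S` up
cost at most a factor `2`, and `m ≥ K/2` costs another; the resulting `32/3` is rounded to `11`. -/
theorem ifoCalls_le {L Ll θ G Δ K : ℝ} (hK : 1 ≤ K) (hm : P.m = ⌊K⌋₊) (hb : P.b = P.m)
    (hL : 0 < L) (hη : P.η = stepSize L Ll θ G) (hε : 0 < P.ε) (hσ : 0 < P.σ)
    (hα : 0 < P.α₁) (hβ : 0 ≤ P.β₁) (hΔ : 0 < Δ)
    (hS : P.S = ⌈4 * Δ / (P.m * P.η * P.ε ^ 2)⌉₊) (hcap : 0 < P.cap n mode)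
    (h1 : 1 ≤ 4 * Δ / (P.m * P.η * P.ε ^ 2)) (d : Draws n P.S P.m P.b) :
    (ifoCalls f R T P mode d : ℝ) ≤
      11 * (Δ * Theta 3 L Ll θ G * avgBatch f R T P mode d / (K * P.ε ^ 2) +
        Δ * Theta 3 L Ll θ G * K / P.ε ^ 2) := by
  have hm0 : 0 < P.m := hm ▸ Nat.floor_pos.2 hK
  have hm' : (0 : ℝ) < P.m := by exact_mod_cast hm0
  have hmK : (P.m : ℝ) ≤ K := hm ▸ Nat.floor_le (zero_le_one.trans hK)
  have hKm : K / 2 ≤ P.m := hm ▸ half_le_floor hK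
  have hη0 : 0 < P.η := hη ▸ stepSize_pos hL
  have hηΘ : P.η * Theta 3 L Ll θ G = 3 / 2 := hη ▸ stepSize_mul_Theta hL
  have hS0 : 0 < P.S := hS ▸ Nat.ceil_pos.2 (zero_lt_one.trans_le h1)
  have hΘ : 0 < Theta 3 L Ll θ G := by
    unfold Theta
    positivity
  have hB := avgBatch_nonneg (f := f) (R := R) (T := T) hσ hα hβ hcap d
  set Θ := Theta 3 L Ll θ G
  have hinv : 4 * Δ / (P.m * P.η * P.ε ^ 2) = 8 / 3 * (Δ * Θ / (P.m * P.ε ^ 2)) := by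
    rw [show Θ = 3 / 2 / P.η by rw [← hηΘ]; field_simp]
    field_simp
    norm_num
  have hSle : (P.S : ℝ) ≤ 16 / 3 * (Δ * Θ / (P.m * P.ε ^ 2)) := by
    have h2 := Nat.ceil_lt_add_one (zero_le_one.trans h1)
    rw [← hS] at h2
    linarith
  have hSK : (P.S : ℝ) ≤ 11 * (Δ * Θ / (K * P.ε ^ 2)) := by
    refine hSle.trans ?_
    calc 16 / 3 * (Δ * Θ / (P.m * P.ε ^ 2)) ≤ 16 / 3 * (Δ * Θ / (K / 2 * P.ε ^ 2)) := by gcongr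
      _ = 32 / 3 * (Δ * Θ / (K * P.ε ^ 2)) := by field_simp; norm_num
      _ ≤ _ := by gcongr; norm_num
  have hSm : (P.S : ℝ) * P.m ^ 2 ≤ 16 / 3 * (Δ * Θ * K / P.ε ^ 2) :=
    calc (P.S : ℝ) * P.m ^ 2 ≤ 16 / 3 * (Δ * Θ / (P.m * P.ε ^ 2)) * P.m ^ 2 := by gcongr
      _ = 16 / 3 * (Δ * Θ * P.m / P.ε ^ 2) := by field_simp
      _ ≤ _ := by gcongr
  have h3 : 0 ≤ Δ * Θ * K / P.ε ^ 2 := by positivity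
  calc (ifoCalls f R T P mode d : ℝ)
      ≤ P.S * avgBatch f R T P mode d + 2 * (P.S * P.m ^ 2) :=
        ifoCalls_le_avgBatch hm0 hb hS0 hσ hα hβ hcap d
    _ ≤ 11 * (Δ * Θ / (K * P.ε ^ 2)) * avgBatch f R T P mode d +
        2 * (16 / 3 * (Δ * Θ * K / P.ε ^ 2)) := by gcongr
    _ = 11 * (Δ * Θ * avgBatch f R T P mode d / (K * P.ε ^ 2)) +
        32 / 3 * (Δ * Θ * K / P.ε ^ 2) := by ring
    _ ≤ _ := by linarith

end Complexity

end AbaSRG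

end

/-! ### The two settings -/

theorem mainTheorem7 :
    ∃ ϱ C : ℝ, 0 < ϱ ∧ 0 < C ∧
      ∀ (E : Type*) [NormedAddCommGroup E] [NormedSpace ℝ E] [FiniteDimensional ℝ E]
        (M : Type*) [TopologicalSpace M] [T2Space M] [ChartedSpace E M]
        [IsManifold 𝓘(ℝ, E) ∞ M]
        [RiemannianBundle (fun x : M => TangentSpace 𝓘(ℝ, E) x)]
        [IsContMDiffRiemannianBundle 𝓘(ℝ, E) ∞ E (fun x : M => TangentSpace 𝓘(ℝ, E) x)]
        (n : ℕ) (f : Fin n → M → ℝ) (R : AbaSRG.Retraction E M) (T : AbaSRG.VectorTransport R)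
        (X : Set M) (xs : M) (δ G L Ll θ Δ Θ₂ : ℝ) (P : AbaSRG.Input M),
        0 < n → 0 ≤ G → 0 < P.σ → 0 < L → 0 ≤ Ll → 0 ≤ θ → 0 < P.ε →
        AbaSRG.Assumptions f R T X xs δ G P.σ L Ll θ →
        Δ = AbaSRG.objective f P.x₀ - AbaSRG.objective f xs → 0 < Δ →
        Θ₂ = AbaSRG.Theta ϱ L Ll θ G →
        P.η = AbaSRG.stepSize L Ll θ G → P.b = P.m →
        P.S = ⌈4 * Δ / (P.m * P.η * P.ε ^ 2)⌉₊ →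
        4 ≤ P.α₁ → 0 < P.β₁ → P.β₁ ≤ P.ε ^ 2 * P.S →
        -- finite-sum setting
        (P.m = ⌊√(n : ℝ)⌋₊ → AbaSRG.StaysIn f R T P .finiteSum X →
          AbaSRG.expectedGradNorm f R T P .finiteSum ≤ P.ε ∧
          (1 ≤ 4 * Δ / (P.m * P.η * P.ε ^ 2) → ∀ d : AbaSRG.Draws n P.S P.m P.b,
            (AbaSRG.ifoCalls f R T P .finiteSum d : ℝ) ≤
              C * (AbaSRG.avgBatch f R T P .finiteSum d +
                Δ * Θ₂ * AbaSRG.avgBatch f R T P .finiteSum d / (√(n : ℝ) * P.ε ^ 2) +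
                Δ * Θ₂ * √(n : ℝ) / P.ε ^ 2))) ∧
        -- online setting
        (4 ≤ P.α₂ → P.ε ≤ P.σ → P.m = ⌊P.σ / P.ε⌋₊ → AbaSRG.StaysIn f R T P .online X →
          AbaSRG.expectedGradNorm f R T P .online ≤ P.ε ∧
          (1 ≤ 4 * Δ / (P.m * P.η * P.ε ^ 2) → ∀ d : AbaSRG.Draws n P.S P.m P.b,
            (AbaSRG.ifoCalls f R T P .online d : ℝ) ≤
              C * (Δ * Θ₂ * AbaSRG.avgBatch f R T P .online d / (P.σ * P.ε) +
                Δ * Θ₂ * P.σ / P.ε ^ 3))) := by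
  -- `ϱ = 3` makes `η Θ₂ = 3/2` exactly; `11` comes from `ifoCalls_le`.
  refine ⟨3, 11, by norm_num, by norm_num, ?_⟩
  intro E _ _ _ M _ _ _ _ _ _ n f R T X xs δ G L Ll θ Δ Θ₂ P hn hG hσ hL hLl hθ hε hA hΔ hΔ0 hΘ hη
    hb hS hα hβ hβS
  subst hΘ
  have hα0 : 0 < P.α₁ := by linarith
  constructor
  · intro hm hstay
    have hK : 1 ≤ √(n : ℝ) := Real.one_le_sqrt.2 (by exact_mod_cast hn)
    have hm0 : 0 < P.m := hm ▸ Nat.floor_pos.2 hK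
    have hcap : 0 < P.cap n .finiteSum := by
      rw [AbaSRG.Input.cap]
      exact_mod_cast hn
    refine ⟨AbaSRG.expectedGradNorm_le hn hm0 hb hA hG hL hLl hθ hη hε hσ hα hβ.le hβS
      (hΔ ▸ hΔ0) (hΔ ▸ hS) hcap (Or.inl le_rfl) hstay, fun h1 d => ?_⟩
    have h := AbaSRG.ifoCalls_le (f := f) (R := R) (T := T) hK hm hb hL hη hε hσ hα0 hβ.le hΔ0 hS
      hcap h1 d
    have hB := AbaSRG.avgBatch_nonneg (f := f) (R := R) (T := T) hσ hα0 hβ.le hcap d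
    -- The separate term `B̃` of the finite-sum bound is only slack here: its nonnegativity
    -- suffices.
    linarith
  · intro hα₂ hεσ hm hstay
    have hK : 1 ≤ P.σ / P.ε := (one_le_div hε).2 hεσ
    have hm0 : 0 < P.m := hm ▸ Nat.floor_pos.2 hK
    have hα₂0 : 0 < P.α₂ := by linarith
    have hcap : 0 < P.cap n .online := by
      rw [AbaSRG.Input.cap]
      positivity
    -- A capped online batch has variance at most `ε²/α₂ ≤ ε²/4`.
    have hcapκ : P.σ ^ 2 ≤ P.ε ^ 2 / 4 * P.cap n .online := by
      rw [AbaSRG.Input.cap]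
      calc P.σ ^ 2 = P.ε ^ 2 / 4 * (4 * P.σ ^ 2 / P.ε ^ 2) := by field_simp
        _ ≤ _ := by gcongr
    refine ⟨AbaSRG.expectedGradNorm_le hn hm0 hb hA hG hL hLl hθ hη hε hσ hα hβ.le hβS
      (hΔ ▸ hΔ0) (hΔ ▸ hS) hcap (Or.inr hcapκ) hstay, fun h1 d => ?_⟩
    have h := AbaSRG.ifoCalls_le (f := f) (R := R) (T := T) hK hm hb hL hη hε hσ hα0 hβ.le hΔ0 hS
      hcap h1 d
    have e1 : P.σ / P.ε * P.ε ^ 2 = P.σ * P.ε := by field_simp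
    have e2 (a : ℝ) : a * (P.σ / P.ε) / P.ε ^ 2 = a * P.σ / P.ε ^ 3 := by field_simp
    rwa [e1, e2] at h
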